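/- **Theorem.** Let $\Omega\subset\mathbb{R}^N$ be a bounded open set and let $T>0$. Let $p\in(1,\infty]$, let $q$ be its conjugate exponent, $\frac1p+\frac1q=1$, and let $\alpha\in[q,\infty]$. Let $u\in L^1(0,T;W^{1,\alpha}(\Omega)^N)$ with $\nabla\cdot u=0$ (that is, for a.e. $t$, $\int_\Omega u(x,t)\cdot\nabla\varphi(x)\,dx=0$ for all $\varphi\in C_c^\infty(\Omega)$), let $\rho_0\in L^p(\Omega)$, and let $\rho\in L^\infty(0,T;L^p(\Omega))$ be a weak solution of $\rho_t-u\cdot\nabla\rho=0$ in $(0,T)\times\Omega$, $\rho(0)=\rho_0$, i.e. $$-\int_0^T\!\int_\Omega \rho\,\phi_t\,dx\,dt-\int_\Omega\rho_0(x)\,\phi(0,x)\,dx+\int_0^T\!\int_\Omega\rho\,(u\cdot\nabla\phi)\,dx\,dt=0\qquad\text{for all }\phi\in C_c^\infty([0,T)\times\Omega).$$ Let $\eta\in C_c^\infty(\mathbb{R}^N)$ with $\eta\ge0$ and $\operatorname{supp}\eta\subset \overline{B(0,1)}$. For $\varepsilon>0$ put $\eta_\varepsilon(x)=\varepsilon^{-N}\eta(x/\varepsilon)$,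 $\Omega_\varepsilon=\{x\in\Omega:\operatorname{dist}(x,\partial\Omega)>\varepsilon\}$, $$\rho_\varepsilon(x,t)=\int_\Omega\rho(y,t)\,\eta_\varepsilon(x-y)\,dy,\qquad \rho^0_\varepsilon(x)=\int_\Omega\rho_0(y)\,\eta_\varepsilon(x-y)\,dy,$$ $$r_\varepsilon(x,t)=\int_\Omega\rho(y,t)\,\big(u(y,t)-u(x,t)\big)\cdot\nabla_x\big[\eta_\varepsilon(x-y)\big]\,dy .$$ Let $\beta\in C^1(\mathbb{R})$ with $\beta$ and $\beta'$ bounded. Let $\phi\in C_c^\infty([0,T)\times\Omega)$ and let $\Omega_0\subset\Omega$ be a compact set such that $\phi(t,x)=0$ for all $t\in[0,T]$ and all $x\in\Omega\setminus\Omega_0$. Then, for every $\varepsilon$ with $0<\varepsilon<\operatorname{dist}(\Omega_0,\partial\Omega)$, $$-\int_0^T\!\int_{\Omega_\varepsilon}\rho_\varepsilon\,\phi_t\,dx\,dt-\int_{\Omega_\varepsilon}\rho^0_\varepsilon\,\phi(0,x)\,dx+\int_0^T\!\int_{\Omega_\varepsilon}\rho_\varepsilon\,u\cdot\nabla\phi\,dx\,dt=\int_0^T\!\int_{\Omega}r_\varepsilon\,\phi\,dx\,dt$$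 and $$-\int_0^T\!\int_{\Omega_\varepsilon}\beta(\rho_\varepsilon)\,\phi_t\,dx\,dt-\int_{\Omega_\varepsilon}\beta(\rho^0_\varepsilon)\,\phi(0,x)\,dx+\int_0^T\!\int_{\Omega_\varepsilon}\beta(\rho_\varepsilon)\,u\cdot\nabla\phi\,dx\,dt=\int_0^T\!\int_{\Omega_\varepsilon}r_\varepsilon\,\beta'(\rho_\varepsilon)\,\phi\,dx\,dt .$$ All the integrals occurring here converge absolutely (those defining $\rho_\varepsilon(\cdot,t)$ and $r_\varepsilon(\cdot,t)$ for almost every $t$). -/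

import Mathlib

open Set MeasureTheory
open scoped ENNReal NNReal ContDiff

noncomputable section

/-- The product of Lebesgue measure on the time interval `(0,T)` and Lebesgue measure on `U`. -/
def spaceTime {N : ℕ} (T : ℝ) (U : Set (EuclideanSpace ℝ (Fin N))) :
    Measure (ℝ × EuclideanSpace ℝ (Fin N)) :=
  (volume.restrict (Ioo 0 T)).prod (volume.restrict U)

/-- `φ ∈ C_c^∞(Ω)`. -/
structure IsSpaceTest {N : ℕ} (Ω : Set (EuclideanSpace ℝ (Fin N)))
    (φ : EuclideanSpace ℝ (Fin N) → ℝ) : Prop where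
  smooth : ContDiff ℝ ∞ φ
  compact : HasCompactSupport φ
  subset : tsupport φ ⊆ Ω

/-- `φ ∈ C_c^∞([0,T) × Ω)`: `φ` is smooth on `[0,T] × Ω` and vanishes there outside some compact
subset of `[0,T) × Ω`. The values of `φ` outside `[0,T] × Ω` are irrelevant. -/
structure IsTest {N : ℕ} (T : ℝ) (Ω : Set (EuclideanSpace ℝ (Fin N)))
    (φ : ℝ → EuclideanSpace ℝ (Fin N) → ℝ) : Prop where
  smooth : ContDiffOn ℝ ∞ (Function.uncurry φ) (Icc 0 T ×ˢ Ω)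
  support : ∃ K : Set (ℝ × EuclideanSpace ℝ (Fin N)), IsCompact K ∧ K ⊆ Ico 0 T ×ˢ Ω ∧
    ∀ t ∈ Icc 0 T, ∀ x ∈ Ω, (t, x) ∉ K → φ t x = 0

/-- `ρ ∈ L^∞(0,T; L^p(Ω))`, in terms of jointly measurable representatives. -/
def MemLinftyLp {N : ℕ} (T : ℝ) (Ω : Set (EuclideanSpace ℝ (Fin N))) (p : ℝ≥0∞)
    (ρ : ℝ → EuclideanSpace ℝ (Fin N) → ℝ) : Prop :=
  AEStronglyMeasurable (Function.uncurry ρ) (spaceTime T Ω) ∧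
    ∃ C : ℝ≥0, ∀ᵐ t ∂(volume.restrict (Ioo 0 T)), eLpNorm (ρ t) p (volume.restrict Ω) ≤ C

/-- `Dv` is the weak (distributional) derivative of the vector field `v` on `Ω`. -/
structure HasWeakDerivOn {N : ℕ} (Ω : Set (EuclideanSpace ℝ (Fin N)))
    (v : EuclideanSpace ℝ (Fin N) → EuclideanSpace ℝ (Fin N))
    (Dv : EuclideanSpace ℝ (Fin N) →
      EuclideanSpace ℝ (Fin N) →L[ℝ] EuclideanSpace ℝ (Fin N)) : Prop where
  locInt : LocallyIntegrableOn v Ω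
  locInt_deriv : LocallyIntegrableOn Dv Ω
  integral_eq : ∀ φ : EuclideanSpace ℝ (Fin N) → ℝ, IsSpaceTest Ω φ →
    ∀ e : EuclideanSpace ℝ (Fin N),
      ∫ x in Ω, (fderiv ℝ φ x e) • v x = -∫ x in Ω, φ x • Dv x e

/-- `u ∈ L^1(0,T; W^{1,α}(Ω)^N)`, in terms of jointly measurable representatives of `u` and of its
weak spatial derivative. -/
def MemL1W1 {N : ℕ} (T : ℝ) (Ω : Set (EuclideanSpace ℝ (Fin N))) (α : ℝ≥0∞)
    (u : ℝ → EuclideanSpace ℝ (Fin N) → EuclideanSpace ℝ (Fin N)) : Prop :=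
  AEStronglyMeasurable (Function.uncurry u) (spaceTime T Ω) ∧
    ∃ Du : ℝ → EuclideanSpace ℝ (Fin N) →
        EuclideanSpace ℝ (Fin N) →L[ℝ] EuclideanSpace ℝ (Fin N),
      AEStronglyMeasurable (Function.uncurry Du) (spaceTime T Ω) ∧
      (∀ᵐ t ∂(volume.restrict (Ioo 0 T)), HasWeakDerivOn Ω (u t) (Du t)) ∧
      ∫⁻ t in Ioo 0 T, (eLpNorm (u t) α (volume.restrict Ω) +
        eLpNorm (Du t) α (volume.restrict Ω)) < (⊤ : ℝ≥0∞)

/-- `∇ · v = 0` on `Ω` in the weak sense; `fderiv ℝ φ x (v x)` is `v(x) · ∇φ(x)`. -/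
def IsWeaklyDivFree {N : ℕ} (Ω : Set (EuclideanSpace ℝ (Fin N)))
    (v : EuclideanSpace ℝ (Fin N) → EuclideanSpace ℝ (Fin N)) : Prop :=
  ∀ φ : EuclideanSpace ℝ (Fin N) → ℝ, IsSpaceTest Ω φ → ∫ x in Ω, fderiv ℝ φ x (v x) = 0

/-- The left-hand side of the weak transport equation on `U`, tested with `φ`:
`-∫₀ᵀ ∫_U w ∂ₜφ dx dt - ∫_U w₀ φ(0,·) dx + ∫₀ᵀ ∫_U w (u · ∇φ) dx dt`. -/
def transportForm {N : ℕ} (T : ℝ) (U : Set (EuclideanSpace ℝ (Fin N)))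
    (u : ℝ → EuclideanSpace ℝ (Fin N) → EuclideanSpace ℝ (Fin N))
    (w : ℝ → EuclideanSpace ℝ (Fin N) → ℝ) (w₀ : EuclideanSpace ℝ (Fin N) → ℝ)
    (φ : ℝ → EuclideanSpace ℝ (Fin N) → ℝ) : ℝ :=
  -(∫ t in Ioo 0 T, ∫ x in U, w t x * deriv (fun s => φ s x) t)
    - (∫ x in U, w₀ x * φ 0 x)
    + ∫ t in Ioo 0 T, ∫ x in U, w t x * fderiv ℝ (φ t) x (u t x)

/-- All the integrals in `transportForm` converge absolutely. -/
structure TransportFormConverges {N : ℕ} (T : ℝ) (U : Set (EuclideanSpace ℝ (Fin N)))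
    (u : ℝ → EuclideanSpace ℝ (Fin N) → EuclideanSpace ℝ (Fin N))
    (w : ℝ → EuclideanSpace ℝ (Fin N) → ℝ) (w₀ : EuclideanSpace ℝ (Fin N) → ℝ)
    (φ : ℝ → EuclideanSpace ℝ (Fin N) → ℝ) : Prop where
  time : Integrable (fun z : ℝ × EuclideanSpace ℝ (Fin N) =>
    w z.1 z.2 * deriv (fun s => φ s z.2) z.1) (spaceTime T U)
  initial : IntegrableOn (fun x => w₀ x * φ 0 x) U
  space : Integrable (fun z : ℝ × EuclideanSpace ℝ (Fin N) =>
    w z.1 z.2 * fderiv ℝ (φ z.1) z.2 (u z.1 z.2)) (spaceTime T U)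

/-- `ρ` satisfies, in the distributional sense, `ρ_t - u · ∇ρ = 0` in `(0,T) × Ω`,
`ρ(0) = ρ₀` (for divergence-free `u`). -/
def IsWeakSolution {N : ℕ} (T : ℝ) (Ω : Set (EuclideanSpace ℝ (Fin N)))
    (u : ℝ → EuclideanSpace ℝ (Fin N) → EuclideanSpace ℝ (Fin N))
    (ρ : ℝ → EuclideanSpace ℝ (Fin N) → ℝ) (ρ₀ : EuclideanSpace ℝ (Fin N) → ℝ) : Prop :=
  ∀ φ : ℝ → EuclideanSpace ℝ (Fin N) → ℝ, IsTest T Ω φ → transportForm T Ω u ρ ρ₀ φ = 0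

/-- `Ω_ε = {x ∈ Ω : dist(x, ∂Ω) > ε}` (with the distance to the empty set being `∞`). -/
def innerSet {N : ℕ} (Ω : Set (EuclideanSpace ℝ (Fin N))) (ε : ℝ) :
    Set (EuclideanSpace ℝ (Fin N)) :=
  {x ∈ Ω | ENNReal.ofReal ε < Metric.infEDist x (frontier Ω)}

/-- `η_ε(x) = ε^{-N} η(x / ε)`. -/
def scaledKernel {N : ℕ} (η : EuclideanSpace ℝ (Fin N) → ℝ) (ε : ℝ)
    (x : EuclideanSpace ℝ (Fin N)) : ℝ :=
  (ε ^ N)⁻¹ * η (ε⁻¹ • x)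

/-- `(f * η_ε)(x) = ∫_Ω f(y) η_ε(x - y) dy`. -/
def mollify {N : ℕ} (Ω : Set (EuclideanSpace ℝ (Fin N))) (η : EuclideanSpace ℝ (Fin N) → ℝ)
    (ε : ℝ) (f : EuclideanSpace ℝ (Fin N) → ℝ) (x : EuclideanSpace ℝ (Fin N)) : ℝ :=
  ∫ y in Ω, f y * scaledKernel η ε (x - y)

/-- The integrand `ρ(y) (v(y) - v(x)) · ∇ₓ[η_ε(x - y)]` of the error term, the gradient being taken
with respect to `x`. -/
def errorIntegrand {N : ℕ} (η : EuclideanSpace ℝ (Fin N) → ℝ) (ε : ℝ)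
    (v : EuclideanSpace ℝ (Fin N) → EuclideanSpace ℝ (Fin N))
    (ρ : EuclideanSpace ℝ (Fin N) → ℝ) (x y : EuclideanSpace ℝ (Fin N)) : ℝ :=
  ρ y * fderiv ℝ (fun z => scaledKernel η ε (z - y)) x (v y - v x)

/-- The error term `r_ε(x) = ∫_Ω ρ(y) (v(y) - v(x)) · ∇ₓ[η_ε(x - y)] dy` at a fixed time. -/
def errorTerm {N : ℕ} (Ω : Set (EuclideanSpace ℝ (Fin N))) (η : EuclideanSpace ℝ (Fin N) → ℝ)
    (ε : ℝ) (v : EuclideanSpace ℝ (Fin N) → EuclideanSpace ℝ (Fin N))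
    (ρ : EuclideanSpace ℝ (Fin N) → ℝ) (x : EuclideanSpace ℝ (Fin N)) : ℝ :=
  ∫ y in Ω, errorIntegrand η ε v ρ x y

end

/-! Fix `x` in Ω_ε. The kernel `y ↦ η_ε(x - y)` is supported in a closed ball inside Ω, so its
product with a function of time is an admissible test function. The weak equation then says that `t
↦ ρ_ε(x,t)` has initial value `ρ⁰_ε(x)` and distributional derivative `D(x,t) = ∫ ρ(y,t) u(y,t) ·
∇η_ε(x - y) dy` (`IsWeakSolution.mollify_time`). Hölder's inequality makes `ρu` integrable on
space-time, so `D(x,·)` is integrable in time and `ρ_ε(x,·)` agrees a.e. with an absolutely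
continuous function. The chain rule for `β` and integration by parts against `φ(·,x)` hold on that
representative (`weak_deriv_comp_mul`). Fubini then integrates the result over `x`.

Splitting `u(y) - u(x)` gives `r_ε = D - u · ∇ρ_ε` (`errorTerm_eq`). What is missing is thus `∫
β(ρ_ε) u · ∇φ = -∫ β'(ρ_ε) (u · ∇ρ_ε) φ` at a.e. time, which is `∇ · u = 0` tested with `β(ρ_ε) φ`.
This function is only C¹, so the divergence condition is first extended to C¹ test functions.

For fixed ε the mollified density is bounded, so the argument works for every C¹ function `β`; the
identity function yields the linear equation. -/

/-! ### Weak derivatives in one variable -/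

theorem LipschitzOnWith.comp_absolutelyContinuousOnInterval {f : ℝ → ℝ} {β : ℝ → ℝ} {K : ℝ≥0}
    {a b : ℝ} {s : Set ℝ} (hβ : LipschitzOnWith K β s) (hf : AbsolutelyContinuousOnInterval f a b)
    (hs : MapsTo f (uIcc a b) s) : AbsolutelyContinuousOnInterval (fun t => β (f t)) a b := by
  rw [absolutelyContinuousOnInterval_iff] at hf ⊢
  intro ε hε
  -- Dividing by `K + 1` covers `K = 0`.
  obtain ⟨δ, hδ, h⟩ := hf (ε / (K + 1)) (by positivity)
  refine ⟨δ, hδ, fun E hE hsum => ?_⟩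
  have h1 := h E hE hsum
  rw [lt_div_iff₀ (by positivity)] at h1
  refine lt_of_le_of_lt ?_ h1
  rw [Finset.sum_mul]
  refine Finset.sum_le_sum fun i hi => ?_
  have hm := hE.1 i hi
  have h2 := hβ.dist_le_mul _ (hs hm.1) _ (hs hm.2)
  nlinarith [dist_nonneg (x := f (E.2 i).1) (y := f (E.2 i).2)]

/-- An integrable function satisfying a first order equation in the distributional sense on `[0,T)`
agrees almost everywhere with the corresponding primitive. -/
theorem ae_eq_primitive_of_weak_deriv {T c : ℝ} (hT : 0 < T) {W g : ℝ → ℝ}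
    (hW : IntegrableOn W (Ioo 0 T)) (hg : IntegrableOn g (Ioo 0 T))
    (h : ∀ ψ : ℝ → ℝ, ContDiff ℝ ∞ ψ → (∃ b < T, ∀ t, b ≤ t → ψ t = 0) →
      -(∫ t in Ioo 0 T, W t * deriv ψ t) - c * ψ 0 = ∫ t in Ioo 0 T, g t * ψ t) :
    ∀ᵐ t ∂(volume.restrict (Ioo 0 T)), W t = c + ∫ s in (0 : ℝ)..t, g s := by
  set R : ℝ → ℝ := fun t => c + ∫ s in (0 : ℝ)..t, g s with hR
  have hgi : IntervalIntegrable g volume 0 T :=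
    (intervalIntegrable_iff_integrableOn_Ioo_of_le hT.le).2 hg
  have hRac : AbsolutelyContinuousOnInterval R 0 T := by
    have h1 : AbsolutelyContinuousOnInterval (fun _ : ℝ => c) 0 T :=
      (contDiff_const.contDiffOn (n := 1)).absolutelyContinuousOnInterval
    exact h1.fun_add (hgi.absolutelyContinuousOnInterval_intervalIntegral (by simp))
  have hRd : ∀ᵐ t, t ∈ uIcc 0 T → deriv R t = g t := by
    filter_upwards [hgi.ae_hasDerivAt_integral] with t ht h2
    exact ((ht h2 0 (by simp)).const_add c).deriv
  have hRi : IntegrableOn R (Ioo 0 T) :=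
    (hRac.continuousOn.integrableOn_compact isCompact_uIcc).mono_set
      (by rw [uIcc_of_le hT.le]; exact Ioo_subset_Icc_self)
  have key : ∀ᵐ t, t ∈ Ioo 0 T → (W - R) t = 0 := by
    refine isOpen_Ioo.ae_eq_zero_of_integral_contDiff_smul_eq_zero
      (hW.sub hRi).locallyIntegrableOn fun θ hθ hθc hθs => ?_
    obtain ⟨b, hbT, hb⟩ : ∃ b < T, ∀ t, b ≤ t → θ t = 0 := by
      rcases (tsupport θ).eq_empty_or_nonempty with he | hne
      · refine ⟨0, hT, fun t _ => ?_⟩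
        exact image_eq_zero_of_notMem_tsupport (by simp [he])
      · obtain ⟨m, hm, hmax⟩ := hθc.isCompact.exists_isGreatest hne
        have hmT := (hθs hm).2
        refine ⟨(m + T) / 2, by linarith, fun t ht => ?_⟩
        refine image_eq_zero_of_notMem_tsupport fun h3 => ?_
        have := hmax h3
        linarith
    -- The primitive based at `T` vanishes near `T`, so it may be inserted in `h`. It need not
    -- vanish at `0`, but the term `c * ψ 0` is matched by `R 0 = c` when `R` is integrated by
    -- parts.
    set ψ : ℝ → ℝ := fun t => ∫ s in T..t, θ s with hψ
    have hψd : ∀ t, HasDerivAt ψ (θ t) t := fun t =>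
      intervalIntegral.integral_hasDerivAt_right (hθ.continuous.intervalIntegrable _ _)
        (hθ.continuous.stronglyMeasurableAtFilter _ _) hθ.continuous.continuousAt
    have hψd' : deriv ψ = θ := funext fun t => (hψd t).deriv
    have hψs : ContDiff ℝ ∞ ψ := by
      refine contDiff_infty_iff_deriv.2 ⟨fun t => (hψd t).differentiableAt, ?_⟩
      rw [hψd']; exact hθ
    have hψ0 : ∀ t, b ≤ t → ψ t = 0 := by
      intro t ht
      refine intervalIntegral.integral_zero_ae (Filter.Eventually.of_forall fun s hs => hb s ?_)
      rcases le_total T t with h4 | h4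
      · rw [uIoc_of_le h4] at hs; linarith [hs.1]
      · rw [uIoc_of_ge h4] at hs; linarith [hs.1]
    have h1 := h ψ hψs ⟨b, hbT, hψ0⟩
    have h2 := hRac.integral_mul_deriv_eq_deriv_mul
      (hψs.of_le (by simp) : ContDiff ℝ 1 ψ).contDiffOn.absolutelyContinuousOnInterval
    have h3 : ∫ t in (0 : ℝ)..T, deriv R t * ψ t = ∫ t in (0 : ℝ)..T, g t * ψ t := by
      refine intervalIntegral.integral_congr_ae ?_
      filter_upwards [hRd] with t ht hm
      rw [ht (uIoc_subset_uIcc hm)]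
    rw [h3, hψ0 T hbT.le] at h2
    simp only [intervalIntegral.integral_of_le hT.le, integral_Ioc_eq_integral_Ioo] at h2
    have h5 : R 0 = c := by simp [hR]
    rw [h5] at h2
    have h6 : ∫ t, θ t • (W - R) t = ∫ t in Ioo 0 T, (W t * deriv ψ t - R t * deriv ψ t) := by
      rw [← setIntegral_eq_integral_of_forall_compl_eq_zero (s := Ioo 0 T)]
      · rw [hψd']
        refine integral_congr_ae (Filter.Eventually.of_forall fun t => ?_)
        simp only [Pi.sub_apply, smul_eq_mul]; ring
      · intro t ht
        rw [image_eq_zero_of_notMem_tsupport fun h7 => ht (hθs h7), zero_smul]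
    obtain ⟨C, hC⟩ := hθc.exists_bound_of_continuous hθ.continuous
    have hm : ∀ f : ℝ → ℝ, IntegrableOn f (Ioo 0 T) →
        IntegrableOn (fun t => f t * deriv ψ t) (Ioo 0 T) := fun f hf => by
      rw [hψd']
      exact hf.mul_bdd (c := C) hθ.continuous.aestronglyMeasurable
        (Filter.Eventually.of_forall hC)
    rw [h6, integral_sub (hm W hW) (hm R hRi), h2]
    linarith
  rw [ae_restrict_iff' measurableSet_Ioo]
  filter_upwards [key] with t ht h1
  exact sub_eq_zero.1 (ht h1)

/-- Chain rule and integration by parts for weak solutions of first order equations. -/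
theorem weak_deriv_comp_mul {T c : ℝ} (hT : 0 < T) {W g : ℝ → ℝ}
    (hW : IntegrableOn W (Ioo 0 T)) (hg : IntegrableOn g (Ioo 0 T))
    (h : ∀ ψ : ℝ → ℝ, ContDiff ℝ ∞ ψ → (∃ b < T, ∀ t, b ≤ t → ψ t = 0) →
      -(∫ t in Ioo 0 T, W t * deriv ψ t) - c * ψ 0 = ∫ t in Ioo 0 T, g t * ψ t)
    {β : ℝ → ℝ} (hβ : ContDiff ℝ 1 β) {φ : ℝ → ℝ} (hφ : ContDiffOn ℝ 1 φ (Icc 0 T))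
    (hφT : φ T = 0) :
    -(∫ t in Ioo 0 T, β (W t) * deriv φ t) - β c * φ 0 =
      ∫ t in Ioo 0 T, deriv β (W t) * g t * φ t := by
  have hWR := ae_eq_primitive_of_weak_deriv hT hW hg h
  set R : ℝ → ℝ := fun t => c + ∫ s in (0 : ℝ)..t, g s with hR
  have hgi : IntervalIntegrable g volume 0 T :=
    (intervalIntegrable_iff_integrableOn_Ioo_of_le hT.le).2 hg
  have hRac : AbsolutelyContinuousOnInterval R 0 T := by
    have h1 : AbsolutelyContinuousOnInterval (fun _ : ℝ => c) 0 T :=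
      (contDiff_const.contDiffOn (n := 1)).absolutelyContinuousOnInterval
    exact h1.fun_add (hgi.absolutelyContinuousOnInterval_intervalIntegral (by simp))
  -- `β` is only locally Lipschitz, which suffices on the bounded range of `R`.
  obtain ⟨C, hC⟩ := hRac.exists_bound
  obtain ⟨K, hK⟩ := (hβ.contDiffOn (s := Icc (-C) C)).exists_lipschitzOnWith (by decide)
    (convex_Icc _ _) isCompact_Icc
  have hβR := hK.comp_absolutelyContinuousOnInterval hRac (fun t ht => abs_le.1 (hC t ht))
  have h2 := hβR.integral_mul_deriv_eq_deriv_mul (g := φ)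
    (ContDiffOn.absolutelyContinuousOnInterval (by rwa [uIcc_of_le hT.le]))
  have h3 : ∫ t in (0 : ℝ)..T, deriv (fun t => β (R t)) t * φ t =
      ∫ t in (0 : ℝ)..T, deriv β (R t) * g t * φ t := by
    refine intervalIntegral.integral_congr_ae ?_
    filter_upwards [hgi.ae_hasDerivAt_integral] with t ht hm
    have h4 : HasDerivAt R (g t) t := (ht (uIoc_subset_uIcc hm) 0 (by simp)).const_add c
    have h8 : HasDerivAt (fun t => β (R t)) (deriv β (R t) * g t) t :=
      (hβ.differentiable one_ne_zero (R t)).hasDerivAt.comp t h4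
    rw [h8.deriv]
  have h5 : R 0 = c := by simp [hR]
  rw [h3, hφT, h5] at h2
  simp only [intervalIntegral.integral_of_le hT.le, integral_Ioc_eq_integral_Ioo] at h2
  have h6 : ∫ t in Ioo 0 T, β (W t) * deriv φ t = ∫ t in Ioo 0 T, β (R t) * deriv φ t := by
    refine integral_congr_ae ?_
    filter_upwards [hWR] with t ht
    rw [ht]
  have h7 : ∫ t in Ioo 0 T, deriv β (W t) * g t * φ t =
      ∫ t in Ioo 0 T, deriv β (R t) * g t * φ t := by
    refine integral_congr_ae ?_
    filter_upwards [hWR] with t ht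
    rw [ht]
  rw [h6, h7, h2]
  ring

/-! ### The inner set and divergence-free fields -/

theorem isOpen_innerSet {N : ℕ} {Ω : Set (EuclideanSpace ℝ (Fin N))} (hΩ : IsOpen Ω) (ε : ℝ) :
    IsOpen (innerSet Ω ε) :=
  hΩ.inter (isOpen_lt continuous_const Metric.continuous_infEDist)

/-- A connected set that meets Ω and leaves it must cross the frontier, and the strict inequality in
`innerSet` keeps the frontier out of the closed ball. -/
theorem closedBall_subset_of_mem_innerSet {N : ℕ} {Ω : Set (EuclideanSpace ℝ (Fin N))}
    (hΩ : IsOpen Ω) {ε : ℝ} (hε : 0 ≤ ε) {x : EuclideanSpace ℝ (Fin N)} (hx : x ∈ innerSet Ω ε) :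
    Metric.closedBall x ε ⊆ Ω := by
  refine (convex_closedBall x ε).isPreconnected.subset_of_closure_inter_subset hΩ
    ⟨x, Metric.mem_closedBall_self hε, hx.1⟩ ?_
  rintro y ⟨hy, hyb⟩
  by_contra hyΩ
  have h1 : Metric.infEDist x (frontier Ω) ≤ edist x y :=
    Metric.infEDist_le_edist_of_mem ⟨hy, by rwa [hΩ.interior_eq]⟩
  have h2 : edist x y ≤ ENNReal.ofReal ε := by
    rw [edist_comm, edist_dist]
    exact ENNReal.ofReal_le_ofReal hyb
  exact absurd hx.2 (not_lt.2 (h1.trans h2))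

/-- A weakly divergence free integrable vector field may be tested with compactly supported
functions of class `C¹`. -/
theorem IsWeaklyDivFree.integral_eq_zero_of_contDiff_one {N : ℕ}
    {Ω : Set (EuclideanSpace ℝ (Fin N))} (hΩ : IsOpen Ω)
    {v : EuclideanSpace ℝ (Fin N) → EuclideanSpace ℝ (Fin N)} (hv : IsWeaklyDivFree Ω v)
    (hvi : IntegrableOn v Ω) {ψ : EuclideanSpace ℝ (Fin N) → ℝ} (hψ : ContDiff ℝ 1 ψ)
    (hc : HasCompactSupport ψ) (hs : tsupport ψ ⊆ Ω) :
    ∫ x in Ω, fderiv ℝ ψ x (v x) = 0 := by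
  obtain ⟨δ, hδ, hδΩ⟩ := hc.isCompact.exists_cthickening_subset_open hΩ hs
  have hd : Continuous (fderiv ℝ ψ) := hψ.continuous_fderiv one_ne_zero
  have huc : UniformContinuous (fderiv ℝ ψ) :=
    (hc.fderiv ℝ).uniformContinuous_of_continuous hd
  have hmeas : ∀ F : EuclideanSpace ℝ (Fin N) → EuclideanSpace ℝ (Fin N) →L[ℝ] ℝ, Continuous F →
      HasCompactSupport F → IntegrableOn (fun x => F x (v x)) Ω := by
    intro F hF hFc
    obtain ⟨C, hC⟩ := hFc.exists_bound_of_continuous hF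
    refine (hvi.norm.const_mul C).mono' ?_ (Filter.Eventually.of_forall fun x => ?_)
    · exact isBoundedBilinearMap_apply.continuous.comp_aestronglyMeasurable
        (hF.aestronglyMeasurable.prodMk hvi.1)
    · exact ((F x).le_opNorm _).trans (by gcongr; exact hC x)
  -- Mollifying `ψ` at a scale below both δ and the modulus of continuity of its gradient gives a
  -- smooth admissible `χ` whose gradient is uniformly within `e` of that of `ψ`.
  have key : ∀ e > 0, |∫ x in Ω, fderiv ℝ ψ x (v x)| ≤ e * ∫ x in Ω, ‖v x‖ := by
    intro e he
    obtain ⟨r, hr, hrd⟩ := Metric.uniformContinuous_iff.1 huc e he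
    set s := min r δ with hs'
    have hs0 : 0 < s := lt_min hr hδ
    let b : ContDiffBump (0 : EuclideanSpace ℝ (Fin N)) := ⟨s / 2, s, by linarith, by linarith⟩
    set χ := convolution (b.normed volume) ψ (ContinuousLinearMap.lsmul ℝ ℝ) volume with hχ
    have hχs : ContDiff ℝ ∞ χ :=
      b.hasCompactSupport_normed.contDiff_convolution_left _ b.contDiff_normed
        hψ.continuous.locallyIntegrable
    have hχsupp : tsupport χ ⊆ Metric.cthickening δ (tsupport ψ) := by
      refine closure_minimal ?_ Metric.isClosed_cthickening
      refine (support_convolution_subset _).trans ?_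
      rintro _ ⟨a, ha, c, hc', rfl⟩
      rw [b.support_normed_eq] at ha
      refine Metric.mem_cthickening_of_dist_le _ c δ _ (subset_tsupport _ hc') ?_
      have : ‖a‖ < s := by simpa using ha
      simpa [dist_eq_norm] using this.le.trans (min_le_right _ _)
    have hχt : IsSpaceTest Ω χ :=
      ⟨hχs, hc.cthickening.of_isClosed_subset (isClosed_tsupport _) hχsupp,
        hχsupp.trans hδΩ⟩
    have hχd : ∀ x, dist (fderiv ℝ χ x) (fderiv ℝ ψ x) ≤ e := by
      intro x
      have h1 := hc.hasFDerivAt_convolution_right (ContinuousLinearMap.lsmul ℝ ℝ)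
        ((b.continuous_normed (μ := volume)).locallyIntegrable (μ := volume)) hψ x
      rw [h1.fderiv]
      refine b.dist_normed_convolution_le (μ := volume) (g := fderiv ℝ ψ)
        hd.aestronglyMeasurable fun y hy => ?_
      exact (hrd ((Metric.mem_ball.1 hy).trans_le (min_le_left _ _))).le
    have h0 := hv χ hχt
    have hi1 := hmeas _ hd (hc.fderiv ℝ)
    have hi2 := hmeas _ (hχs.continuous_fderiv (by simp)) (hχt.compact.fderiv ℝ)
    have h2 : ∫ x in Ω, fderiv ℝ ψ x (v x) =
        ∫ x in Ω, (fderiv ℝ ψ x (v x) - fderiv ℝ χ x (v x)) := by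
      rw [integral_sub hi1 hi2, h0, sub_zero]
    rw [h2, ← integral_const_mul, ← Real.norm_eq_abs]
    refine norm_integral_le_of_norm_le (hvi.norm.const_mul e)
      (Filter.Eventually.of_forall fun x => ?_)
    rw [← sub_apply]
    refine ((fderiv ℝ ψ x - fderiv ℝ χ x).le_opNorm _).trans ?_
    gcongr
    rw [← dist_eq_norm, dist_comm]
    exact hχd x
  have h0 : 0 ≤ ∫ x in Ω, ‖v x‖ := integral_nonneg fun x => norm_nonneg _
  rw [← abs_nonpos_iff]
  refine le_of_forall_pos_le_add fun e he => ?_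
  refine (key (e / ((∫ x in Ω, ‖v x‖) + 1)) (by positivity)).trans ?_
  rw [div_mul_eq_mul_div, div_le_iff₀ (by positivity)]
  nlinarith

/-! ### Regularity and bounds for test functions -/

namespace IsTest

variable {N : ℕ} {T : ℝ} {Ω : Set (EuclideanSpace ℝ (Fin N))}
  {φ : ℝ → EuclideanSpace ℝ (Fin N) → ℝ}

theorem apply_end (hφ : IsTest T Ω φ) (hT : 0 < T) {x : EuclideanSpace ℝ (Fin N)} (hx : x ∈ Ω) :
    φ T x = 0 := by
  obtain ⟨K, -, hK, h⟩ := hφ.support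
  exact h T ⟨hT.le, le_rfl⟩ x hx fun hm => lt_irrefl _ (hK hm).1.2

theorem uniqueDiffOn (hT : 0 < T) (hΩ : IsOpen Ω) : UniqueDiffOn ℝ (Icc 0 T ×ˢ Ω) :=
  (uniqueDiffOn_Icc hT).prod hΩ.uniqueDiffOn

theorem contDiffOn_time (hφ : IsTest T Ω φ) {x : EuclideanSpace ℝ (Fin N)} (hx : x ∈ Ω) :
    ContDiffOn ℝ 1 (fun t => φ t x) (Icc 0 T) :=
  (hφ.smooth.of_le (by simp)).comp (f := fun t : ℝ => (t, x)) (by fun_prop)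
    fun _ ht => ⟨ht, hx⟩

theorem contDiffOn_space (hφ : IsTest T Ω φ) {t : ℝ} (ht : t ∈ Icc 0 T) :
    ContDiffOn ℝ ∞ (φ t) Ω :=
  hφ.smooth.comp (f := fun x : EuclideanSpace ℝ (Fin N) => (t, x)) (by fun_prop)
    fun _ hx => ⟨ht, hx⟩

theorem exists_bound (hφ : IsTest T Ω φ) : ∃ C, ∀ t ∈ Icc 0 T, ∀ x ∈ Ω, ‖φ t x‖ ≤ C := by
  obtain ⟨K, hKc, hK, h⟩ := hφ.support
  obtain ⟨C, hC⟩ := hKc.exists_bound_of_continuousOn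
    (hφ.smooth.continuousOn.mono (hK.trans (prod_mono Ico_subset_Icc_self subset_rfl)))
  refine ⟨max C 0, fun t ht x hx => ?_⟩
  by_cases hm : (t, x) ∈ K
  · exact (hC _ hm).trans (le_max_left _ _)
  · rw [h t ht x hx hm, norm_zero]; exact le_max_right _ _

/-- Compactness bounds the derivative on `K`; off `K` the function vanishes locally within the
domain. The derivative is taken within `[0,T] × Ω` because the values of `φ` elsewhere are
arbitrary. -/
theorem exists_bound_fderivWithin (hφ : IsTest T Ω φ) (hT : 0 < T) (hΩ : IsOpen Ω) :
    ∃ C, ∀ z ∈ Icc 0 T ×ˢ Ω,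
      ‖fderivWithin ℝ (Function.uncurry φ) (Icc 0 T ×ˢ Ω) z‖ ≤ C := by
  obtain ⟨K, hKc, hK, h⟩ := hφ.support
  have hcont := hφ.smooth.continuousOn_fderivWithin (uniqueDiffOn hT hΩ) (by simp)
  obtain ⟨C, hC⟩ := hKc.exists_bound_of_continuousOn
    (hcont.mono (hK.trans (prod_mono Ico_subset_Icc_self subset_rfl)))
  refine ⟨max C 0, fun z hz => ?_⟩
  by_cases hm : z ∈ K
  · exact (hC _ hm).trans (le_max_left _ _)
  · have h1 : Function.uncurry φ =ᶠ[nhdsWithin z (Icc 0 T ×ˢ Ω)] fun _ => 0 := by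
      filter_upwards [self_mem_nhdsWithin,
        mem_nhdsWithin_of_mem_nhds (hKc.isClosed.isOpen_compl.mem_nhds hm)] with y hy hyK
      exact h y.1 hy.1 y.2 hy.2 hyK
    rw [h1.fderivWithin_eq_of_mem hz, fderivWithin_const_apply, norm_zero]
    exact le_max_right _ _

/-- At interior times the domain is a neighbourhood, so the derivative within it is a genuine one.
Bounds and continuity of both partial derivatives are read off from it. -/
theorem hasFDerivAt (hφ : IsTest T Ω φ) (hΩ : IsOpen Ω) {t : ℝ} (ht : t ∈ Ioo 0 T)
    {x : EuclideanSpace ℝ (Fin N)} (hx : x ∈ Ω) :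
    HasFDerivAt (Function.uncurry φ)
      (fderivWithin ℝ (Function.uncurry φ) (Icc 0 T ×ˢ Ω) (t, x)) (t, x) :=
  (hφ.smooth.differentiableOn (by simp) _
    ⟨Ioo_subset_Icc_self ht, hx⟩).hasFDerivWithinAt.hasFDerivAt
    (prod_mem_nhds (Icc_mem_nhds ht.1 ht.2) (hΩ.mem_nhds hx))

theorem deriv_time (hφ : IsTest T Ω φ) (hΩ : IsOpen Ω) {t : ℝ} (ht : t ∈ Ioo 0 T)
    {x : EuclideanSpace ℝ (Fin N)} (hx : x ∈ Ω) :
    deriv (fun s => φ s x) t =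
      fderivWithin ℝ (Function.uncurry φ) (Icc 0 T ×ˢ Ω) (t, x) (1, 0) := by
  have h1 : HasDerivAt (fun s : ℝ => (s, x)) ((1 : ℝ), (0 : EuclideanSpace ℝ (Fin N))) t :=
    (hasDerivAt_id t).prodMk (hasDerivAt_const t x)
  have h2 : HasDerivAt (fun s => φ s x) _ t :=
    (hφ.hasFDerivAt hΩ ht hx).comp_hasDerivAt (f := fun s : ℝ => (s, x)) t h1
  exact h2.deriv

theorem fderiv_space (hφ : IsTest T Ω φ) (hΩ : IsOpen Ω) {t : ℝ} (ht : t ∈ Ioo 0 T)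
    {x : EuclideanSpace ℝ (Fin N)} (hx : x ∈ Ω) :
    fderiv ℝ (φ t) x =
      (fderivWithin ℝ (Function.uncurry φ) (Icc 0 T ×ˢ Ω) (t, x)).comp
        (ContinuousLinearMap.inr ℝ ℝ (EuclideanSpace ℝ (Fin N))) := by
  have h2 : HasFDerivAt (φ t) _ x :=
    (hφ.hasFDerivAt hΩ ht hx).comp x (hasFDerivAt_prodMk_right t x)
  exact h2.fderiv

theorem exists_bound_deriv (hφ : IsTest T Ω φ) (hT : 0 < T) (hΩ : IsOpen Ω) :
    ∃ C, ∀ t ∈ Ioo 0 T, ∀ x ∈ Ω, ‖deriv (fun s => φ s x) t‖ ≤ C ∧ ‖fderiv ℝ (φ t) x‖ ≤ C := by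
  obtain ⟨C, hC⟩ := hφ.exists_bound_fderivWithin hT hΩ
  refine ⟨C, fun t ht x hx => ?_⟩
  have h := hC (t, x) ⟨Ioo_subset_Icc_self ht, hx⟩
  refine ⟨?_, ?_⟩
  · rw [hφ.deriv_time hΩ ht hx]
    refine (ContinuousLinearMap.le_opNorm _ _).trans ?_
    simpa using h
  · rw [hφ.fderiv_space hΩ ht hx]
    refine (ContinuousLinearMap.opNorm_comp_le _ _).trans (le_trans ?_ h)
    exact mul_le_of_le_one_right (norm_nonneg _) (ContinuousLinearMap.norm_inr_le_one ℝ ℝ _)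

theorem _root_.spaceTime_eq (U : Set (EuclideanSpace ℝ (Fin N))) :
    spaceTime T U = volume.restrict (Ioo 0 T ×ˢ U) := by
  rw [spaceTime, Measure.prod_restrict, ← Measure.volume_eq_prod]

theorem continuousOn (hφ : IsTest T Ω φ) : ContinuousOn (Function.uncurry φ) (Ioo 0 T ×ˢ Ω) :=
  hφ.smooth.continuousOn.mono (prod_mono Ioo_subset_Icc_self subset_rfl)

theorem continuousOn_deriv_time (hφ : IsTest T Ω φ) (hT : 0 < T) (hΩ : IsOpen Ω) :
    ContinuousOn (fun z : ℝ × EuclideanSpace ℝ (Fin N) => deriv (fun s => φ s z.2) z.1)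
      (Ioo 0 T ×ˢ Ω) := by
  have hcont := (hφ.smooth.continuousOn_fderivWithin (uniqueDiffOn hT hΩ) (by simp)).mono
    (prod_mono Ioo_subset_Icc_self subset_rfl)
  refine (hcont.clm_apply (g := fun _ => (1, 0)) continuousOn_const).congr fun z hz => ?_
  exact hφ.deriv_time hΩ hz.1 hz.2

theorem continuousOn_fderiv_space (hφ : IsTest T Ω φ) (hT : 0 < T) (hΩ : IsOpen Ω) :
    ContinuousOn (fun z : ℝ × EuclideanSpace ℝ (Fin N) => fderiv ℝ (φ z.1) z.2)
      (Ioo 0 T ×ˢ Ω) := by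
  have hcont := (hφ.smooth.continuousOn_fderivWithin (uniqueDiffOn hT hΩ) (by simp)).mono
    (prod_mono Ioo_subset_Icc_self subset_rfl)
  refine (hcont.clm_comp (continuousOn_const
    (c := ContinuousLinearMap.inr ℝ ℝ (EuclideanSpace ℝ (Fin N))))).congr fun z hz => ?_
  exact hφ.fderiv_space hΩ hz.1 hz.2

/-- The extension by zero of a time slice of a test function is smooth. -/
theorem contDiff_indicator (hφ : IsTest T Ω φ) (hΩ : IsOpen Ω)
    {Ω₀ : Set (EuclideanSpace ℝ (Fin N))} (hΩ₀ : IsCompact Ω₀) {t : ℝ} (ht : t ∈ Icc 0 T)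
    (hΩ₀Ω : Ω₀ ⊆ Ω) (hφ0 : ∀ x ∈ Ω, x ∉ Ω₀ → φ t x = 0) : ContDiff ℝ ∞ (Ω.indicator (φ t)) := by
  refine contDiff_iff_contDiffAt.2 fun x => ?_
  by_cases hx : x ∈ Ω
  · refine ((hφ.contDiffOn_space ht).contDiffAt (hΩ.mem_nhds hx)).congr_of_eventuallyEq ?_
    filter_upwards [hΩ.mem_nhds hx] with y hy
    exact indicator_of_mem hy _
  · have h0 : x ∈ Ω₀ᶜ := fun h => hx (hΩ₀Ω h)
    refine (contDiffAt_const (c := 0)).congr_of_eventuallyEq ?_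
    filter_upwards [hΩ₀.isClosed.isOpen_compl.mem_nhds h0] with y hy
    by_cases hyΩ : y ∈ Ω
    · rw [indicator_of_mem hyΩ]; exact hφ0 y hyΩ hy
    · exact indicator_of_notMem hyΩ _

end IsTest

/-! ### Convolution of integrable data with a bounded kernel -/

section Convolution

variable {E F₁ F₂ F₃ : Type*} [NormedAddCommGroup E]
  [NormedAddCommGroup F₁] [NormedSpace ℝ F₁] [NormedAddCommGroup F₂] [NormedSpace ℝ F₂]
  [NormedAddCommGroup F₃] [NormedSpace ℝ F₃]

variable {f : E → F₁} {F : E → F₂} {M : ℝ}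

/-- The bilinear map `L` is left general to serve three cases: `mul` for the mollified density,
`lsmul` for its gradient, and `apply` for the divergence of the mollified flux. -/
theorem norm_convolution_integrand_le (hM : ∀ z, ‖F z‖ ≤ M) (L : F₁ →L[ℝ] F₂ →L[ℝ] F₃) (x y : E) :
    ‖L (f y) (F (x - y))‖ ≤ ‖L‖ * M * ‖f y‖ := by
  refine (L.le_opNorm₂ _ _).trans ?_
  rw [mul_right_comm]
  gcongr
  exact hM _

variable [MeasurableSpace E] {ν : Measure E}

theorem norm_convolution_le (hf : Integrable f ν)
    (hM : ∀ z, ‖F z‖ ≤ M) (L : F₁ →L[ℝ] F₂ →L[ℝ] F₃) (x : E) :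
    ‖∫ y, L (f y) (F (x - y)) ∂ν‖ ≤ ‖L‖ * M * ∫ y, ‖f y‖ ∂ν := by
  rw [← integral_const_mul]
  exact norm_integral_le_of_norm_le (hf.norm.const_mul _)
    (Filter.Eventually.of_forall (norm_convolution_integrand_le hM L x))

variable [BorelSpace E] [SecondCountableTopology E]

theorem aestronglyMeasurable_parametric_convolution {μ : Measure ℝ} [SFinite μ] {κ : Measure E}
    [SFinite ν] [SFinite κ] {h : ℝ → E → F₁}
    (hh : AEStronglyMeasurable (Function.uncurry h) (μ.prod ν)) {F : E → F₂} (hF : Continuous F)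
    (L : F₁ →L[ℝ] F₂ →L[ℝ] F₃) :
    AEStronglyMeasurable (fun z : ℝ × E => ∫ y, L (h z.1 y) (F (z.2 - y)) ∂ν) (μ.prod κ) := by
  have h1 : AEStronglyMeasurable (fun w : (ℝ × E) × E => h w.1.1 w.2) ((μ.prod κ).prod ν) :=
    hh.comp_quasiMeasurePreserving
      (QuasiMeasurePreserving.prodMap Measure.quasiMeasurePreserving_fst
        (Measure.QuasiMeasurePreserving.id ν))
  have h2 : AEStronglyMeasurable (fun w : (ℝ × E) × E => F (w.1.2 - w.2)) ((μ.prod κ).prod ν) :=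
    (by fun_prop : Continuous fun w : (ℝ × E) × E => F (w.1.2 - w.2)).aestronglyMeasurable
  exact (L.continuous₂.comp_aestronglyMeasurable (h1.prodMk h2)).integral_prod_right'

theorem integrable_convolution_integrand (hf : Integrable f ν) (hF : Continuous F)
    (hM : ∀ z, ‖F z‖ ≤ M) (L : F₁ →L[ℝ] F₂ →L[ℝ] F₃) (x : E) :
    Integrable (fun y => L (f y) (F (x - y))) ν := by
  refine (hf.norm.const_mul (‖L‖ * M)).mono' ?_
    (Filter.Eventually.of_forall (norm_convolution_integrand_le hM L x))
  exact L.continuous₂.comp_aestronglyMeasurable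
    (hf.1.prodMk (by fun_prop : Continuous fun y => F (x - y)).aestronglyMeasurable)

/-- The dominating function is a multiple of the L¹ norm of `h t`; it depends on time only, so
finiteness of `κ` is enough. -/
theorem integrable_parametric_convolution {μ : Measure ℝ} [SFinite μ] {κ : Measure E} [SFinite ν]
    [IsFiniteMeasure κ] {h : ℝ → E → F₁} (hh : Integrable (Function.uncurry h) (μ.prod ν))
    (hF : Continuous F) (hM : ∀ z, ‖F z‖ ≤ M) (L : F₁ →L[ℝ] F₂ →L[ℝ] F₃) :
    Integrable (fun z : ℝ × E => ∫ y, L (h z.1 y) (F (z.2 - y)) ∂ν) (μ.prod κ) := by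
  refine (((hh.norm.integral_prod_left).comp_fst κ).const_mul (‖L‖ * M)).mono'
    (aestronglyMeasurable_parametric_convolution hh.1 hF L) ?_
  filter_upwards [Measure.quasiMeasurePreserving_fst.ae hh.prod_right_ae] with z hz
  exact norm_convolution_le hz hM L z.2

/-- This holds for every `x`, whereas slicing the joint statement would give almost every `x` only.
-/
theorem integrable_parametric_convolution_apply {μ : Measure ℝ} [SFinite μ] [SFinite ν]
    {h : ℝ → E → F₁} (hh : Integrable (Function.uncurry h) (μ.prod ν))
    (hF : Continuous F) (hM : ∀ z, ‖F z‖ ≤ M) (L : F₁ →L[ℝ] F₂ →L[ℝ] F₃) (x : E) :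
    Integrable (fun t => ∫ y, L (h t y) (F (x - y)) ∂ν) μ := by
  have h1 : Integrable (fun w : ℝ × E => L (h w.1 w.2) (F (x - w.2))) (μ.prod ν) := by
    refine (hh.norm.const_mul (‖L‖ * M)).mono' ?_
      (Filter.Eventually.of_forall fun w => norm_convolution_integrand_le hM L x w.2)
    exact L.continuous₂.comp_aestronglyMeasurable
      (hh.1.prodMk (by fun_prop : Continuous fun w : ℝ × E => F (x - w.2)).aestronglyMeasurable)
  exact h1.integral_prod_left

end Convolution

/-! ### Integrability from the mixed norms -/

section Holder

variable {N : ℕ} {T : ℝ} {Ω : Set (EuclideanSpace ℝ (Fin N))}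

/-- The constant does not depend on `f`, so it can be used at all times at once and pulled out of
the time integral. -/
theorem exists_eLpNorm_le_mul_eLpNorm {X F : Type*} [MeasurableSpace X] [NormedAddCommGroup F]
    (μ : Measure X) [IsFiniteMeasure μ] {q p : ℝ≥0∞} (hqp : q ≤ p) :
    ∃ c : ℝ≥0∞, c ≠ ⊤ ∧ ∀ f : X → F, AEStronglyMeasurable f μ →
      eLpNorm f q μ ≤ c * eLpNorm f p μ := by
  -- For `q = 0` the convention `1 / 0 = 0` may make the exponent below negative, and the power
  -- infinite for the zero measure.
  by_cases hq : q = 0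
  · exact ⟨0, by simp, fun f _ => by simp [hq]⟩
  refine ⟨μ univ ^ (1 / q.toReal - 1 / p.toReal), ?_, fun f hf => ?_⟩
  · refine ENNReal.rpow_ne_top_of_nonneg ?_ (measure_ne_top _ _)
    rcases eq_or_ne p ⊤ with rfl | hp
    · simp
    · have h1 : 0 < q.toReal := ENNReal.toReal_pos hq (ne_top_of_le_ne_top hp hqp)
      have h2 : q.toReal ≤ p.toReal := ENNReal.toReal_mono hp hqp
      exact sub_nonneg.2 (one_div_le_one_div_of_le h1 h2)
  · rw [mul_comm]
    exact eLpNorm_le_eLpNorm_mul_rpow_measure_univ hqp hf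

theorem integrable_spaceTime_of_lintegral_le {F : Type*} [NormedAddCommGroup F]
    {h : ℝ → EuclideanSpace ℝ (Fin N) → F}
    (hh : AEStronglyMeasurable (Function.uncurry h) (spaceTime T Ω)) {c : ℝ≥0∞} (hc : c ≠ ⊤)
    {m : ℝ → ℝ≥0∞} (hm : ∫⁻ t in Ioo 0 T, m t < ⊤)
    (hle : ∀ᵐ t ∂(volume.restrict (Ioo 0 T)), eLpNorm (h t) 1 (volume.restrict Ω) ≤ c * m t) :
    Integrable (Function.uncurry h) (spaceTime T Ω) := by
  refine ⟨hh, ?_⟩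
  rw [hasFiniteIntegral_iff_enorm, spaceTime, lintegral_prod _ hh.enorm]
  refine lt_of_le_of_lt (lintegral_mono_ae (g := fun t => c * m t) ?_) ?_
  · filter_upwards [hle] with t ht
    rw [eLpNorm_one_eq_lintegral_enorm] at ht
    exact ht
  · rw [lintegral_const_mul' _ _ hc]
    exact ENNReal.mul_lt_top hc.lt_top hm

theorem MemLinftyLp.exists_integral_norm_le [IsFiniteMeasure (volume.restrict Ω)] {p : ℝ≥0∞}
    (hp : 1 ≤ p) {ρ : ℝ → EuclideanSpace ℝ (Fin N) → ℝ} (hρ : MemLinftyLp T Ω p ρ) :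
    ∃ C : ℝ, 0 ≤ C ∧ ∀ᵐ t ∂(volume.restrict (Ioo 0 T)), IntegrableOn (ρ t) Ω ∧
      ∫ y in Ω, ‖ρ t y‖ ≤ C := by
  obtain ⟨hm, C, hC⟩ := hρ
  obtain ⟨c, hc, hcle⟩ := exists_eLpNorm_le_mul_eLpNorm (F := ℝ) (volume.restrict Ω) hp
  refine ⟨(c * C).toReal, ENNReal.toReal_nonneg, ?_⟩
  filter_upwards [hC, hm.prodMk_left] with t ht htm
  replace htm : AEStronglyMeasurable (ρ t) (volume.restrict Ω) := htm
  have h1 : eLpNorm (ρ t) 1 (volume.restrict Ω) ≤ c * C := (hcle _ htm).trans (by gcongr)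
  have h2 : c * C < ⊤ := ENNReal.mul_lt_top hc.lt_top ENNReal.coe_lt_top
  refine ⟨memLp_one_iff_integrable.1 ⟨htm, h1.trans_lt h2⟩, ?_⟩
  rw [eLpNorm_one_eq_lintegral_enorm] at h1
  rw [integral_norm_eq_lintegral_enorm htm]
  exact ENNReal.toReal_mono h2.ne h1

theorem MemL1W1.integrable [IsFiniteMeasure (volume.restrict Ω)] {α : ℝ≥0∞} (hα : 1 ≤ α)
    {u : ℝ → EuclideanSpace ℝ (Fin N) → EuclideanSpace ℝ (Fin N)} (hu : MemL1W1 T Ω α u) :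
    Integrable (Function.uncurry u) (spaceTime T Ω) := by
  obtain ⟨hm, Du, -, -, hfin⟩ := hu
  obtain ⟨c, hc, hcle⟩ := exists_eLpNorm_le_mul_eLpNorm (F := EuclideanSpace ℝ (Fin N))
    (volume.restrict Ω) hα
  refine integrable_spaceTime_of_lintegral_le hm hc hfin ?_
  filter_upwards [hm.prodMk_left] with t htm
  exact (hcle _ htm).trans (by gcongr; exact le_self_add)

/-- Hölder at each time: the Lᵖ norm of `ρ t` is essentially bounded, and the L^q norm of `u t` is
controlled by its L^α norm, which is integrable in time. -/
theorem MemLinftyLp.integrable_smul [IsFiniteMeasure (volume.restrict Ω)] {p q α : ℝ≥0∞}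
    (hpq : ENNReal.HolderConjugate p q) (hα : q ≤ α) {ρ : ℝ → EuclideanSpace ℝ (Fin N) → ℝ}
    (hρ : MemLinftyLp T Ω p ρ) {u : ℝ → EuclideanSpace ℝ (Fin N) → EuclideanSpace ℝ (Fin N)}
    (hu : MemL1W1 T Ω α u) :
    Integrable (Function.uncurry fun t y => ρ t y • u t y) (spaceTime T Ω) := by
  obtain ⟨hm, Du, -, -, hfin⟩ := hu
  obtain ⟨hρm, C, hC⟩ := hρ
  obtain ⟨c, hc, hcle⟩ := exists_eLpNorm_le_mul_eLpNorm (F := EuclideanSpace ℝ (Fin N))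
    (volume.restrict Ω) hα
  refine integrable_spaceTime_of_lintegral_le (hρm.smul hm) (c := C * c)
    (ENNReal.mul_lt_top ENNReal.coe_lt_top hc.lt_top).ne hfin ?_
  filter_upwards [hm.prodMk_left, hρm.prodMk_left, hC] with t htm hρtm ht
  refine (eLpNorm_smul_le_mul_eLpNorm (p := p) (q := q) htm hρtm).trans ?_
  rw [mul_assoc]
  refine mul_le_mul' ht ((hcle _ htm).trans ?_)
  gcongr
  exact le_self_add

end Holder

/-! ### The mollified density and the error term -/

section Kernel

variable {N : ℕ} {T : ℝ} {Ω : Set (EuclideanSpace ℝ (Fin N))}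

theorem contDiff_scaledKernel {η : EuclideanSpace ℝ (Fin N) → ℝ} (hη : ContDiff ℝ ∞ η) (ε : ℝ) :
    ContDiff ℝ ∞ (scaledKernel η ε) :=
  contDiff_const.mul (hη.comp (contDiff_const_smul ε⁻¹))

theorem tsupport_scaledKernel_subset {η : EuclideanSpace ℝ (Fin N) → ℝ}
    (hη : tsupport η ⊆ Metric.closedBall 0 1) {ε : ℝ} (hε : 0 < ε) :
    tsupport (scaledKernel η ε) ⊆ Metric.closedBall 0 ε := by
  refine closure_minimal (fun x hx => ?_) Metric.isClosed_closedBall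
  have h1 : ε⁻¹ • x ∈ Metric.closedBall (0 : EuclideanSpace ℝ (Fin N)) 1 :=
    hη (subset_tsupport _ (right_ne_zero_of_mul hx))
  rw [mem_closedBall_zero_iff, norm_smul, norm_inv, Real.norm_of_nonneg hε.le,
    inv_mul_le_iff₀ hε, mul_one] at h1
  exact mem_closedBall_zero_iff.2 h1

theorem hasCompactSupport_scaledKernel {η : EuclideanSpace ℝ (Fin N) → ℝ}
    (hη : tsupport η ⊆ Metric.closedBall 0 1) {ε : ℝ} (hε : 0 < ε) :
    HasCompactSupport (scaledKernel η ε) :=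
  (isCompact_closedBall _ _).of_isClosed_subset (isClosed_tsupport _)
    (tsupport_scaledKernel_subset hη hε)

theorem exists_bound_scaledKernel {η : EuclideanSpace ℝ (Fin N) → ℝ} (hη : ContDiff ℝ ∞ η)
    (hηs : tsupport η ⊆ Metric.closedBall 0 1) {ε : ℝ} (hε : 0 < ε) :
    ∃ M, (∀ z, ‖scaledKernel η ε z‖ ≤ M) ∧ ∀ z, ‖fderiv ℝ (scaledKernel η ε) z‖ ≤ M := by
  have hk := contDiff_scaledKernel hη ε
  have hc := hasCompactSupport_scaledKernel hηs hε
  obtain ⟨A, hA⟩ := hc.exists_bound_of_continuous hk.continuous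
  obtain ⟨B, hB⟩ := (hc.fderiv ℝ).exists_bound_of_continuous (hk.continuous_fderiv (by simp))
  exact ⟨max A B, fun z => (hA z).trans (le_max_left _ _), fun z => (hB z).trans (le_max_right _ _)⟩

/-- The gradient of `mollify Ω η ε f`. -/
noncomputable def mollifyGradient (Ω : Set (EuclideanSpace ℝ (Fin N)))
    (η : EuclideanSpace ℝ (Fin N) → ℝ) (ε : ℝ) (f : EuclideanSpace ℝ (Fin N) → ℝ)
    (x : EuclideanSpace ℝ (Fin N)) : EuclideanSpace ℝ (Fin N) →L[ℝ] ℝ :=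
  ∫ y in Ω, f y • fderiv ℝ (scaledKernel η ε) (x - y)

/-- The divergence of the mollification of the vector field `h`. -/
noncomputable def mollifyDivergence (Ω : Set (EuclideanSpace ℝ (Fin N)))
    (η : EuclideanSpace ℝ (Fin N) → ℝ) (ε : ℝ)
    (h : EuclideanSpace ℝ (Fin N) → EuclideanSpace ℝ (Fin N)) (x : EuclideanSpace ℝ (Fin N)) : ℝ :=
  ∫ y in Ω, fderiv ℝ (scaledKernel η ε) (x - y) (h y)

theorem mollify_eq_convolution (hΩ : MeasurableSet Ω) (η : EuclideanSpace ℝ (Fin N) → ℝ) (ε : ℝ)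
    (f : EuclideanSpace ℝ (Fin N) → ℝ) :
    mollify Ω η ε f = convolution (Ω.indicator f) (scaledKernel η ε)
      (ContinuousLinearMap.lsmul ℝ ℝ) volume := by
  funext x
  rw [mollify, convolution, ← integral_indicator hΩ]
  congr 1
  funext y
  by_cases hy : y ∈ Ω <;> simp [hy]

theorem hasFDerivAt_mollify (hΩ : MeasurableSet Ω) {η : EuclideanSpace ℝ (Fin N) → ℝ}
    (hη : ContDiff ℝ ∞ η) (hηs : tsupport η ⊆ Metric.closedBall 0 1) {ε : ℝ} (hε : 0 < ε)
    {f : EuclideanSpace ℝ (Fin N) → ℝ} (hf : IntegrableOn f Ω) (x : EuclideanSpace ℝ (Fin N)) :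
    HasFDerivAt (mollify Ω η ε f) (mollifyGradient Ω η ε f x) x := by
  have h1 := (hasCompactSupport_scaledKernel hηs hε).hasFDerivAt_convolution_right
    (ContinuousLinearMap.lsmul ℝ ℝ) (hf.integrable_indicator hΩ).locallyIntegrable
    ((contDiff_scaledKernel hη ε).of_le (by simp)) x
  rw [mollify_eq_convolution hΩ]
  refine h1.congr_fderiv ?_
  rw [mollifyGradient, convolution, ← integral_indicator hΩ]
  congr 1
  funext y
  by_cases hy : y ∈ Ω
  · simp only [hy, indicator_of_mem]; rfl
  · simp [hy]

theorem contDiff_mollify (hΩ : MeasurableSet Ω) {η : EuclideanSpace ℝ (Fin N) → ℝ}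
    (hη : ContDiff ℝ ∞ η) (hηs : tsupport η ⊆ Metric.closedBall 0 1) {ε : ℝ} (hε : 0 < ε)
    {f : EuclideanSpace ℝ (Fin N) → ℝ} (hf : IntegrableOn f Ω) :
    ContDiff ℝ ∞ (mollify Ω η ε f) := by
  rw [mollify_eq_convolution hΩ]
  exact (hasCompactSupport_scaledKernel hηs hε).contDiff_convolution_right
    _ (hf.integrable_indicator hΩ).locallyIntegrable (contDiff_scaledKernel hη ε)

/-- Splitting `v y - v x` separates the flux `r v` at `y`, which yields a divergence, from the value
`v x`, which leaves the integral over `y` and meets the gradient of the mollified density. -/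
theorem errorIntegrand_eq (η : EuclideanSpace ℝ (Fin N) → ℝ) (ε : ℝ)
    (v : EuclideanSpace ℝ (Fin N) → EuclideanSpace ℝ (Fin N))
    (r : EuclideanSpace ℝ (Fin N) → ℝ) (x y : EuclideanSpace ℝ (Fin N)) :
    errorIntegrand η ε v r x y = fderiv ℝ (scaledKernel η ε) (x - y) (r y • v y) -
      (r y • fderiv ℝ (scaledKernel η ε) (x - y)) (v x) := by
  rw [errorIntegrand, fderiv_comp_sub]
  simp [mul_sub]

section Integrable

variable {η : EuclideanSpace ℝ (Fin N) → ℝ} (hη : ContDiff ℝ ∞ η)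
  (hηs : tsupport η ⊆ Metric.closedBall 0 1) {ε : ℝ} (hε : 0 < ε)
  {r : EuclideanSpace ℝ (Fin N) → ℝ} (hr : IntegrableOn r Ω)

include hη hηs hε hr

theorem integrableOn_mul_scaledKernel (x : EuclideanSpace ℝ (Fin N)) :
    IntegrableOn (fun y => r y * scaledKernel η ε (x - y)) Ω := by
  obtain ⟨M, hM, -⟩ := exists_bound_scaledKernel hη hηs hε
  exact integrable_convolution_integrand hr (contDiff_scaledKernel hη ε).continuous hM
    (ContinuousLinearMap.mul ℝ ℝ) x

theorem integrableOn_smul_fderiv_scaledKernel (x : EuclideanSpace ℝ (Fin N)) :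
    IntegrableOn (fun y => r y • fderiv ℝ (scaledKernel η ε) (x - y)) Ω := by
  obtain ⟨M, -, hM⟩ := exists_bound_scaledKernel hη hηs hε
  exact integrable_convolution_integrand hr
    ((contDiff_scaledKernel hη ε).continuous_fderiv (by simp)) hM (ContinuousLinearMap.lsmul ℝ ℝ) x

omit hr in
theorem integrableOn_fderiv_scaledKernel_apply
    {h : EuclideanSpace ℝ (Fin N) → EuclideanSpace ℝ (Fin N)} (hh : IntegrableOn h Ω)
    (x : EuclideanSpace ℝ (Fin N)) :
    IntegrableOn (fun y => fderiv ℝ (scaledKernel η ε) (x - y) (h y)) Ω := by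
  obtain ⟨M, -, hM⟩ := exists_bound_scaledKernel hη hηs hε
  exact integrable_convolution_integrand hh
    ((contDiff_scaledKernel hη ε).continuous_fderiv (by simp)) hM
    (ContinuousLinearMap.apply ℝ ℝ) x

variable {v : EuclideanSpace ℝ (Fin N) → EuclideanSpace ℝ (Fin N)}
  (hrv : IntegrableOn (fun y => r y • v y) Ω)

include hrv

theorem integrableOn_errorIntegrand (x : EuclideanSpace ℝ (Fin N)) :
    IntegrableOn (errorIntegrand η ε v r x) Ω := by
  rw [funext (errorIntegrand_eq η ε v r x)]
  exact (integrableOn_fderiv_scaledKernel_apply hη hηs hε hrv x).sub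
    ((integrableOn_smul_fderiv_scaledKernel hη hηs hε hr x).apply_continuousLinearMap (v x))

theorem errorTerm_eq (x : EuclideanSpace ℝ (Fin N)) :
    errorTerm Ω η ε v r x =
      mollifyDivergence Ω η ε (fun y => r y • v y) x - mollifyGradient Ω η ε r x (v x) := by
  have h1 := integrableOn_smul_fderiv_scaledKernel hη hηs hε hr x
  rw [errorTerm, funext (errorIntegrand_eq η ε v r x),
    integral_sub (integrableOn_fderiv_scaledKernel_apply hη hηs hε hrv x)
      (h1.apply_continuousLinearMap (v x)), mollifyGradient,
    ContinuousLinearMap.integral_apply h1, mollifyDivergence]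

end Integrable

/-- Testing the weak equation with products of a function of time and a translated kernel. -/
theorem IsWeakSolution.mollify_time (hΩ : IsOpen Ω)
    {u : ℝ → EuclideanSpace ℝ (Fin N) → EuclideanSpace ℝ (Fin N)}
    {ρ : ℝ → EuclideanSpace ℝ (Fin N) → ℝ} {ρ₀ : EuclideanSpace ℝ (Fin N) → ℝ}
    (hsol : IsWeakSolution T Ω u ρ ρ₀)
    {η : EuclideanSpace ℝ (Fin N) → ℝ} (hη : ContDiff ℝ ∞ η)
    (hηs : tsupport η ⊆ Metric.closedBall 0 1) {ε : ℝ} (hε : 0 < ε)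
    {x : EuclideanSpace ℝ (Fin N)} (hx : x ∈ innerSet Ω ε) {ψ : ℝ → ℝ} (hψ : ContDiff ℝ ∞ ψ)
    (hψ0 : ∃ b < T, ∀ t, b ≤ t → ψ t = 0) :
    -(∫ t in Ioo 0 T, mollify Ω η ε (ρ t) x * deriv ψ t) - mollify Ω η ε ρ₀ x * ψ 0 =
      ∫ t in Ioo 0 T, mollifyDivergence Ω η ε (fun y => ρ t y • u t y) x * ψ t := by
  obtain ⟨b, hb, hψb⟩ := hψ0
  have hk := contDiff_scaledKernel hη ε
  have htest : IsTest T Ω (fun t y => ψ t * scaledKernel η ε (x - y)) := by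
    refine ⟨?_, Icc 0 b ×ˢ Metric.closedBall x ε,
      isCompact_Icc.prod (isCompact_closedBall _ _),
      prod_mono (Icc_subset_Ico_right hb) (closedBall_subset_of_mem_innerSet hΩ hε.le hx), ?_⟩
    · exact ((hψ.comp contDiff_fst).mul
        (hk.comp (contDiff_const.sub contDiff_snd))).contDiffOn
    · intro t ht y _ hm
      by_cases htb : b ≤ t
      · rw [hψb t htb, zero_mul]
      · refine mul_eq_zero_of_right _ (image_eq_zero_of_notMem_tsupport fun h => hm ?_)
        refine ⟨⟨ht.1, (not_le.1 htb).le⟩, ?_⟩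
        have := tsupport_scaledKernel_subset hηs hε h
        rwa [mem_closedBall_zero_iff, ← dist_eq_norm, dist_comm] at this
  have h := hsol _ htest
  -- Differentiating in `y` rather than `x` produces the minus sign that moves the transport term to
  -- the right-hand side.
  have hd : ∀ t y v, fderiv ℝ (fun y => ψ t * scaledKernel η ε (x - y)) y v =
      -(ψ t * fderiv ℝ (scaledKernel η ε) (x - y) v) := by
    intro t y v
    have h1 : HasFDerivAt (fun y => scaledKernel η ε (x - y)) _ y :=
      ((hk.differentiable (by simp)) (x - y)).hasFDerivAt.comp y
        ((hasFDerivAt_id y).const_sub x)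
    rw [(h1.const_mul (ψ t)).fderiv]
    simp
  have hd' : ∀ t y, deriv (fun s => ψ s * scaledKernel η ε (x - y)) t =
      deriv ψ t * scaledKernel η ε (x - y) := fun t y =>
    deriv_mul_const ((hψ.differentiable (by simp)) t) _
  have e1 : ∀ t, ∫ y in Ω, ρ t y * deriv (fun s => ψ s * scaledKernel η ε (x - y)) t =
      mollify Ω η ε (ρ t) x * deriv ψ t := by
    intro t
    rw [mollify, ← integral_mul_const]
    congr 1; funext y; rw [hd']; ring
  have e2 : ∫ y in Ω, ρ₀ y * (ψ 0 * scaledKernel η ε (x - y)) = mollify Ω η ε ρ₀ x * ψ 0 := by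
    rw [mollify, ← integral_mul_const]
    congr 1; funext y; ring
  have e3 : ∀ t, ∫ y in Ω, ρ t y * fderiv ℝ (fun y => ψ t * scaledKernel η ε (x - y)) y (u t y) =
      -(mollifyDivergence Ω η ε (fun y => ρ t y • u t y) x * ψ t) := by
    intro t
    rw [mollifyDivergence, ← integral_mul_const, ← integral_neg]
    congr 1; funext y; rw [hd, map_smul, smul_eq_mul]; ring
  simp only [transportForm, e1, e2, e3, integral_neg] at h
  linarith

end Kernel

/-! ### The renormalized equation -/

variable {N : ℕ} {T : ℝ} {Ω : Set (EuclideanSpace ℝ (Fin N))}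

theorem spaceTime_mono {U V : Set (EuclideanSpace ℝ (Fin N))} (h : U ⊆ V) :
    spaceTime T U ≤ spaceTime T V := by
  rw [spaceTime_eq, spaceTime_eq]
  exact Measure.restrict_mono (prod_mono subset_rfl h) le_rfl

theorem ae_spaceTime_of_ae_time {U : Set (EuclideanSpace ℝ (Fin N))} {P : ℝ → Prop}
    (h : ∀ᵐ t ∂(volume.restrict (Ioo 0 T)), P t) : ∀ᵐ z ∂(spaceTime T U), P z.1 :=
  Measure.quasiMeasurePreserving_fst.ae h

theorem ae_mem_spaceTime {U : Set (EuclideanSpace ℝ (Fin N))} (hU : MeasurableSet U) :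
    ∀ᵐ z ∂(spaceTime T U), z ∈ Ioo 0 T ×ˢ U := by
  rw [spaceTime_eq]
  exact ae_restrict_mem (measurableSet_Ioo.prod hU)

theorem exists_bound_comp {β : ℝ → ℝ} (hβ : Continuous β) (B : ℝ) :
    ∃ C, ∀ s, ‖s‖ ≤ B → ‖β s‖ ≤ C := by
  obtain ⟨C, hC⟩ := (isCompact_closedBall (0 : ℝ) B).exists_bound_of_continuousOn hβ.continuousOn
  exact ⟨C, fun s hs => hC s (by simpa using hs)⟩

/-- At a fixed time, the transport term of a function of the mollified density can be integrated
by parts. -/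
theorem IsTest.integral_comp_mollify_mul_fderiv (hΩ : IsOpen Ω)
    {η : EuclideanSpace ℝ (Fin N) → ℝ} (hη : ContDiff ℝ ∞ η)
    (hηs : tsupport η ⊆ Metric.closedBall 0 1) {ε : ℝ} (hε : 0 < ε)
    {β : ℝ → ℝ} (hβ : ContDiff ℝ 1 β)
    {φ : ℝ → EuclideanSpace ℝ (Fin N) → ℝ} (hφ : IsTest T Ω φ)
    {Ω₀ : Set (EuclideanSpace ℝ (Fin N))} (hΩ₀ : IsCompact Ω₀) (hΩ₀Ω : Ω₀ ⊆ Ω)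
    (hΩ₀ε : Ω₀ ⊆ innerSet Ω ε) {t : ℝ} (ht : t ∈ Ioo 0 T)
    (hφ0 : ∀ x ∈ Ω, x ∉ Ω₀ → φ t x = 0)
    {f : EuclideanSpace ℝ (Fin N) → ℝ} (hf : IntegrableOn f Ω)
    {v : EuclideanSpace ℝ (Fin N) → EuclideanSpace ℝ (Fin N)} (hv : IntegrableOn v Ω)
    (hdiv : IsWeaklyDivFree Ω v)
    (h1 : IntegrableOn (fun x => β (mollify Ω η ε f x) * fderiv ℝ (φ t) x (v x)) (innerSet Ω ε))
    (h2 : IntegrableOn (fun x => deriv β (mollify Ω η ε f x) * mollifyGradient Ω η ε f x (v x) *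
      φ t x) (innerSet Ω ε)) :
    ∫ x in innerSet Ω ε, β (mollify Ω η ε f x) * fderiv ℝ (φ t) x (v x) =
      -∫ x in innerSet Ω ε, deriv β (mollify Ω η ε f x) * mollifyGradient Ω η ε f x (v x) *
        φ t x := by
  have htc := Ioo_subset_Icc_self ht
  have hind := hφ.contDiff_indicator hΩ hΩ₀ htc hΩ₀Ω hφ0
  -- The indicator discards the arbitrary values of `φ t` outside Ω.
  set ψ : EuclideanSpace ℝ (Fin N) → ℝ := fun x => β (mollify Ω η ε f x) * Ω.indicator (φ t) x
    with hψ
  have hψs : ContDiff ℝ 1 ψ :=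
    (hβ.comp ((contDiff_mollify hΩ.measurableSet hη hηs hε hf).of_le (by simp))).mul
      (hind.of_le (by simp))
  have hsupp : tsupport ψ ⊆ Ω₀ := by
    refine closure_minimal (fun x hx => ?_) hΩ₀.isClosed
    by_contra hx0
    refine hx (mul_eq_zero_of_right _ ?_)
    by_cases hxΩ : x ∈ Ω
    · rw [indicator_of_mem hxΩ, hφ0 x hxΩ hx0]
    · exact indicator_of_notMem hxΩ _
  have h0 := hdiv.integral_eq_zero_of_contDiff_one hΩ hv hψs
    (hΩ₀.of_isClosed_subset (isClosed_tsupport _) hsupp) (hsupp.trans hΩ₀Ω)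
  have hd : ∀ x ∈ Ω, fderiv ℝ ψ x (v x) =
      β (mollify Ω η ε f x) * fderiv ℝ (φ t) x (v x) +
        deriv β (mollify Ω η ε f x) * mollifyGradient Ω η ε f x (v x) * φ t x := by
    intro x hx
    have a1 : HasFDerivAt (fun x => β (mollify Ω η ε f x))
        (deriv β (mollify Ω η ε f x) • mollifyGradient Ω η ε f x) x :=
      (hβ.differentiable one_ne_zero _).hasDerivAt.comp_hasFDerivAt x
        (hasFDerivAt_mollify hΩ.measurableSet hη hηs hε hf x)
    have a2 : HasFDerivAt (Ω.indicator (φ t)) (fderiv ℝ (φ t) x) x := by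
      refine (((hφ.contDiffOn_space htc).contDiffAt (hΩ.mem_nhds hx)).differentiableAt
        (by simp)).hasFDerivAt.congr_of_eventuallyEq ?_
      filter_upwards [hΩ.mem_nhds hx] with y hy
      exact indicator_of_mem hy _
    rw [hψ, HasFDerivAt.fderiv (a1.fun_mul a2)]
    simp only [add_apply, smul_apply, smul_eq_mul, indicator_of_mem hx]
    ring
  rw [eq_neg_iff_add_eq_zero, ← integral_add h1 h2, ← h0, eq_comm,
    setIntegral_congr_fun hΩ.measurableSet hd]
  -- Outside the inner set `φ t` vanishes near each point of Ω, hence so does its gradient, and both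
  -- terms drop out.
  refine setIntegral_eq_of_subset_of_forall_sdiff_eq_zero hΩ.measurableSet
    (fun x hx => hx.1) fun x hx => ?_
  have hx0 : x ∉ Ω₀ := fun h => hx.2 (hΩ₀ε h)
  have h3 : φ t =ᶠ[nhds x] fun _ => 0 := by
    filter_upwards [hΩ.mem_nhds hx.1, hΩ₀.isClosed.isOpen_compl.mem_nhds hx0] with y hy hy0
    exact hφ0 y hy hy0
  rw [h3.fderiv_eq, fderiv_const_apply, hφ0 x hx.1 hx0]
  simp

/-- The renormalized equation for the mollified density, for integrable data. -/
theorem transportForm_comp_mollify (hΩ : IsOpen Ω) [IsFiniteMeasure (volume.restrict Ω)]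
    (hT : 0 < T)
    {u : ℝ → EuclideanSpace ℝ (Fin N) → EuclideanSpace ℝ (Fin N)}
    (hu : Integrable (Function.uncurry u) (spaceTime T Ω))
    (hdiv : ∀ᵐ t ∂(volume.restrict (Ioo 0 T)), IsWeaklyDivFree Ω (u t))
    {ρ₀ : EuclideanSpace ℝ (Fin N) → ℝ} (hρ₀ : IntegrableOn ρ₀ Ω)
    {ρ : ℝ → EuclideanSpace ℝ (Fin N) → ℝ}
    (hρm : AEStronglyMeasurable (Function.uncurry ρ) (spaceTime T Ω)) {R : ℝ}
    (hρ : ∀ᵐ t ∂(volume.restrict (Ioo 0 T)), IntegrableOn (ρ t) Ω ∧ ∫ y in Ω, ‖ρ t y‖ ≤ R)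
    (hρu : Integrable (Function.uncurry fun t y => ρ t y • u t y) (spaceTime T Ω))
    (hsol : IsWeakSolution T Ω u ρ ρ₀)
    {η : EuclideanSpace ℝ (Fin N) → ℝ} (hη : ContDiff ℝ ∞ η)
    (hηs : tsupport η ⊆ Metric.closedBall 0 1) {ε : ℝ} (hε : 0 < ε)
    {β : ℝ → ℝ} (hβ : ContDiff ℝ 1 β)
    {φ : ℝ → EuclideanSpace ℝ (Fin N) → ℝ} (hφ : IsTest T Ω φ)
    {Ω₀ : Set (EuclideanSpace ℝ (Fin N))} (hΩ₀ : IsCompact Ω₀) (hΩ₀Ω : Ω₀ ⊆ Ω)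
    (hφ0 : ∀ t ∈ Icc 0 T, ∀ x ∈ Ω, x ∉ Ω₀ → φ t x = 0) (hΩ₀ε : Ω₀ ⊆ innerSet Ω ε) :
    TransportFormConverges T (innerSet Ω ε) u
        (fun t x => β (mollify Ω η ε (ρ t) x)) (fun x => β (mollify Ω η ε ρ₀ x)) φ ∧
      Integrable (fun z : ℝ × EuclideanSpace ℝ (Fin N) =>
        errorTerm Ω η ε (u z.1) (ρ z.1) z.2 * deriv β (mollify Ω η ε (ρ z.1) z.2) * φ z.1 z.2)
        (spaceTime T (innerSet Ω ε)) ∧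
      transportForm T (innerSet Ω ε) u
          (fun t x => β (mollify Ω η ε (ρ t) x)) (fun x => β (mollify Ω η ε ρ₀ x)) φ =
        ∫ t in Ioo 0 T, ∫ x in innerSet Ω ε,
          errorTerm Ω η ε (u t) (ρ t) x * deriv β (mollify Ω η ε (ρ t) x) * φ t x := by
  set U := innerSet Ω ε with hU
  have hUo : IsOpen U := isOpen_innerSet hΩ ε
  have hUm := hUo.measurableSet
  have hUΩ : U ⊆ Ω := fun x hx => hx.1
  have : IsFiniteMeasure (volume.restrict U) :=
    isFiniteMeasure_of_le (volume.restrict Ω) (Measure.restrict_mono hUΩ le_rfl)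
  have : IsFiniteMeasure (spaceTime T U) := by rw [spaceTime]; infer_instance
  obtain ⟨M, hM, hM'⟩ := exists_bound_scaledKernel hη hηs hε
  have hk := contDiff_scaledKernel hη ε
  have hkc : Continuous (fderiv ℝ (scaledKernel η ε)) := hk.continuous_fderiv (by simp)
  -- measurability
  have mW : AEStronglyMeasurable
      (fun z : ℝ × EuclideanSpace ℝ (Fin N) => mollify Ω η ε (ρ z.1) z.2) (spaceTime T U) :=
    aestronglyMeasurable_parametric_convolution hρm hk.continuous (ContinuousLinearMap.mul ℝ ℝ)
  have mG : AEStronglyMeasurable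
      (fun z : ℝ × EuclideanSpace ℝ (Fin N) => mollifyGradient Ω η ε (ρ z.1) z.2)
      (spaceTime T U) :=
    aestronglyMeasurable_parametric_convolution hρm hkc (ContinuousLinearMap.lsmul ℝ ℝ)
  have mβ := hβ.continuous.comp_aestronglyMeasurable mW
  have mβ' := (hβ.continuous_deriv le_rfl).comp_aestronglyMeasurable mW
  have mcont : ∀ {F : Type} [NormedAddCommGroup F] [NormedSpace ℝ F] [SecondCountableTopology F]
      {h : ℝ × EuclideanSpace ℝ (Fin N) → F}, ContinuousOn h (Ioo 0 T ×ˢ Ω) →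
      AEStronglyMeasurable h (spaceTime T U) := by
    intro F _ _ _ h hh
    rw [spaceTime_eq]
    exact (hh.mono (prod_mono subset_rfl hUΩ)).aestronglyMeasurable (measurableSet_Ioo.prod hUm)
  have mφ : AEStronglyMeasurable (fun z : ℝ × EuclideanSpace ℝ (Fin N) => φ z.1 z.2)
      (spaceTime T U) := mcont hφ.continuousOn
  have mφt := mcont (hφ.continuousOn_deriv_time hT hΩ)
  have mφx := mcont (hφ.continuousOn_fderiv_space hT hΩ)
  -- bounds
  set B := max (‖ContinuousLinearMap.mul ℝ ℝ‖ * M * R)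
    (‖ContinuousLinearMap.mul ℝ ℝ‖ * M * ∫ y in Ω, ‖ρ₀ y‖) with hB
  have hM0 : 0 ≤ M := (norm_nonneg _).trans (hM 0)
  have bW : ∀ᵐ t ∂(volume.restrict (Ioo 0 T)), ∀ x, ‖mollify Ω η ε (ρ t) x‖ ≤ B := by
    filter_upwards [hρ] with t ht x
    refine (norm_convolution_le ht.1 hM (ContinuousLinearMap.mul ℝ ℝ) x).trans
      (le_trans ?_ (le_max_left _ _))
    gcongr
    exact ht.2
  have bW0 : ∀ x, ‖mollify Ω η ε ρ₀ x‖ ≤ B := fun x =>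
    (norm_convolution_le hρ₀ hM (ContinuousLinearMap.mul ℝ ℝ) x).trans (le_max_right _ _)
  have bG : ∀ᵐ t ∂(volume.restrict (Ioo 0 T)), ∀ x, ‖mollifyGradient Ω η ε (ρ t) x‖ ≤
      ‖(ContinuousLinearMap.lsmul ℝ ℝ :
        ℝ →L[ℝ] (EuclideanSpace ℝ (Fin N) →L[ℝ] ℝ) →L[ℝ] _)‖ * M * R := by
    filter_upwards [hρ] with t ht x
    refine (norm_convolution_le ht.1 hM' (ContinuousLinearMap.lsmul ℝ ℝ) x).trans ?_
    gcongr
    exact ht.2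
  obtain ⟨Cβ, hCβ⟩ := exists_bound_comp hβ.continuous B
  obtain ⟨Cβ', hCβ'⟩ := exists_bound_comp (hβ.continuous_deriv le_rfl) B
  obtain ⟨Cφ, hCφ⟩ := hφ.exists_bound
  obtain ⟨Cd, hCd⟩ := hφ.exists_bound_deriv hT hΩ
  have bβ : ∀ᵐ z ∂(spaceTime T U), ‖β (mollify Ω η ε (ρ z.1) z.2)‖ ≤ Cβ := by
    filter_upwards [ae_spaceTime_of_ae_time bW] with z hz using hCβ _ (hz _)
  have bβ' : ∀ᵐ z ∂(spaceTime T U), ‖deriv β (mollify Ω η ε (ρ z.1) z.2)‖ ≤ Cβ' := by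
    filter_upwards [ae_spaceTime_of_ae_time bW] with z hz using hCβ' _ (hz _)
  have bφ : ∀ᵐ z ∂(spaceTime T U), ‖φ z.1 z.2‖ ≤ Cφ := by
    filter_upwards [ae_mem_spaceTime hUm] with z hz
    exact hCφ _ (Ioo_subset_Icc_self hz.1) _ (hUΩ hz.2)
  -- integrability
  have iu : Integrable (Function.uncurry u) (spaceTime T U) :=
    hu.mono_measure (spaceTime_mono hUΩ)
  have iclm : ∀ {A : ℝ × EuclideanSpace ℝ (Fin N) → EuclideanSpace ℝ (Fin N) →L[ℝ] ℝ} {C : ℝ},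
      AEStronglyMeasurable A (spaceTime T U) → (∀ᵐ z ∂(spaceTime T U), ‖A z‖ ≤ C) →
      Integrable (fun z => A z (u z.1 z.2)) (spaceTime T U) := by
    intro A C hA hC
    refine (iu.norm.const_mul C).mono'
      (isBoundedBilinearMap_apply.continuous.comp_aestronglyMeasurable (hA.prodMk iu.1)) ?_
    filter_upwards [hC] with z hz
    exact ((A z).le_opNorm _).trans (mul_le_mul_of_nonneg_right hz (norm_nonneg _))
  have I1 : Integrable (fun z : ℝ × EuclideanSpace ℝ (Fin N) =>
      β (mollify Ω η ε (ρ z.1) z.2) * deriv (fun s => φ s z.2) z.1) (spaceTime T U) := by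
    refine (Integrable.of_bound mφt Cd ?_).bdd_mul (c := Cβ) mβ bβ
    filter_upwards [ae_mem_spaceTime hUm] with z hz using (hCd _ hz.1 _ (hUΩ hz.2)).1
  have I2 : IntegrableOn (fun x => β (mollify Ω η ε ρ₀ x) * φ 0 x) U := by
    have m0 : AEStronglyMeasurable (φ 0) (volume.restrict U) :=
      ((hφ.contDiffOn_space ⟨le_rfl, hT.le⟩).continuousOn.mono hUΩ).aestronglyMeasurable hUm
    refine (Integrable.of_bound m0 Cφ ?_).bdd_mul (c := Cβ)
      (hβ.continuous.comp (contDiff_mollify hΩ.measurableSet hη hηs hε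
        hρ₀).continuous).aestronglyMeasurable (Filter.Eventually.of_forall fun x => hCβ _ (bW0 x))
    filter_upwards [ae_restrict_mem hUm] with x hx using hCφ 0 ⟨le_rfl, hT.le⟩ x (hUΩ hx)
  have I3 : Integrable (fun z : ℝ × EuclideanSpace ℝ (Fin N) =>
      β (mollify Ω η ε (ρ z.1) z.2) * fderiv ℝ (φ z.1) z.2 (u z.1 z.2)) (spaceTime T U) := by
    refine (iclm mφx (C := Cd) ?_).bdd_mul (c := Cβ) mβ bβ
    filter_upwards [ae_mem_spaceTime hUm] with z hz using (hCd _ hz.1 _ (hUΩ hz.2)).2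
  have I4 : Integrable (fun z : ℝ × EuclideanSpace ℝ (Fin N) =>
      deriv β (mollify Ω η ε (ρ z.1) z.2) *
        mollifyDivergence Ω η ε (fun y => ρ z.1 y • u z.1 y) z.2 * φ z.1 z.2)
      (spaceTime T U) := by
    have hg : Integrable (fun z : ℝ × EuclideanSpace ℝ (Fin N) =>
        mollifyDivergence Ω η ε (fun y => ρ z.1 y • u z.1 y) z.2) (spaceTime T U) :=
      integrable_parametric_convolution hρu hkc hM' (ContinuousLinearMap.apply ℝ ℝ)
    exact (hg.bdd_mul (c := Cβ') mβ' bβ').mul_bdd (c := Cφ) mφ bφ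
  have I5 : Integrable (fun z : ℝ × EuclideanSpace ℝ (Fin N) =>
      deriv β (mollify Ω η ε (ρ z.1) z.2) * mollifyGradient Ω η ε (ρ z.1) z.2 (u z.1 z.2) *
        φ z.1 z.2) (spaceTime T U) :=
    ((iclm mG (ae_spaceTime_of_ae_time bG |>.mono fun z hz => hz z.2)).bdd_mul
      (c := Cβ') mβ' bβ').mul_bdd (c := Cφ) mφ bφ
  have herr : ∀ᵐ t ∂(volume.restrict (Ioo 0 T)), ∀ x,
      errorTerm Ω η ε (u t) (ρ t) x * deriv β (mollify Ω η ε (ρ t) x) * φ t x =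
        deriv β (mollify Ω η ε (ρ t) x) * mollifyDivergence Ω η ε (fun y => ρ t y • u t y) x *
          φ t x -
        deriv β (mollify Ω η ε (ρ t) x) * mollifyGradient Ω η ε (ρ t) x (u t x) * φ t x := by
    filter_upwards [hρ, hρu.prod_right_ae] with t ht hut x
    rw [errorTerm_eq hη hηs hε ht.1 hut]
    ring
  refine ⟨⟨I1, I2, I3⟩, (I4.sub I5).congr ?_, ?_⟩
  · filter_upwards [ae_spaceTime_of_ae_time herr] with z hz
    exact (hz z.2).symm
  have hρi : Integrable (Function.uncurry ρ) (spaceTime T Ω) := by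
    refine (integrable_prod_iff hρm).2 ⟨hρ.mono fun t ht => ht.1, ?_⟩
    refine Integrable.of_bound hρm.norm.integral_prod_right' R ?_
    filter_upwards [hρ] with t ht
    rw [Real.norm_of_nonneg (integral_nonneg fun _ => norm_nonneg _)]
    exact ht.2
  have htime : ∀ x ∈ U, -(∫ t in Ioo 0 T, β (mollify Ω η ε (ρ t) x) * deriv (fun s => φ s x) t) -
      β (mollify Ω η ε ρ₀ x) * φ 0 x = ∫ t in Ioo 0 T, deriv β (mollify Ω η ε (ρ t) x) *
        mollifyDivergence Ω η ε (fun y => ρ t y • u t y) x * φ t x := fun x hx =>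
    weak_deriv_comp_mul hT
      (integrable_parametric_convolution_apply hρi hk.continuous hM
        (ContinuousLinearMap.mul ℝ ℝ) x)
      (integrable_parametric_convolution_apply hρu hkc hM' (ContinuousLinearMap.apply ℝ ℝ) x)
      (fun ψ hψ hψ0 => hsol.mollify_time hΩ hη hηs hε hx hψ hψ0) hβ
      (hφ.contDiffOn_time (hUΩ hx)) (hφ.apply_end hT (hUΩ hx))
  -- The identity `htime`, valid at each `x`, is integrated over the inner set; `I1` and `I4`
  -- justify Fubini on the two sides.
  have hswap : -(∫ t in Ioo 0 T, ∫ x in U,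
        β (mollify Ω η ε (ρ t) x) * deriv (fun s => φ s x) t) -
      (∫ x in U, β (mollify Ω η ε ρ₀ x) * φ 0 x) =
      ∫ t in Ioo 0 T, ∫ x in U, deriv β (mollify Ω η ε (ρ t) x) *
        mollifyDivergence Ω η ε (fun y => ρ t y • u t y) x * φ t x := by
    have s1 := integral_integral_swap (μ := volume.restrict (Ioo 0 T)) (ν := volume.restrict U)
      (f := fun t x => β (mollify Ω η ε (ρ t) x) * deriv (fun s => φ s x) t) I1
    have s4 := integral_integral_swap (μ := volume.restrict (Ioo 0 T)) (ν := volume.restrict U)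
      (f := fun t x => deriv β (mollify Ω η ε (ρ t) x) *
        mollifyDivergence Ω η ε (fun y => ρ t y • u t y) x * φ t x) I4
    rw [s1, s4, ← integral_neg]
    exact (integral_sub I1.integral_prod_right.neg I2).symm.trans
      (setIntegral_congr_fun hUm htime)
  -- At a.e. time it remains to turn the transport term into minus the gradient part of the error
  -- term.
  rw [transportForm, hswap, ← integral_add I4.integral_prod_left I3.integral_prod_left]
  refine integral_congr_ae ?_
  filter_upwards [hρ, hu.prod_right_ae, hdiv, herr, ae_restrict_mem measurableSet_Ioo,
    I3.prod_right_ae, I4.prod_right_ae, I5.prod_right_ae] with t ht hut htd hte htm j3 j4 j5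
  replace hut : IntegrableOn (u t) Ω := hut
  simp only [hte]
  rw [integral_sub j4 j5, hφ.integral_comp_mollify_mul_fderiv hΩ hη hηs hε hβ hΩ₀ hΩ₀Ω hΩ₀ε htm
    (hφ0 t (Ioo_subset_Icc_self htm)) ht.1 hut htd j3 j5, sub_eq_add_neg]

theorem mainTheorem9 {N : ℕ} (Ω : Set (EuclideanSpace ℝ (Fin N)))
    (hΩo : IsOpen Ω) (hΩb : Bornology.IsBounded Ω)
    (T : ℝ) (hT : 0 < T)
    (p q α : ℝ≥0∞) (hp : 1 < p) (hpq : ENNReal.HolderConjugate p q) (hα : q ≤ α)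
    (u : ℝ → EuclideanSpace ℝ (Fin N) → EuclideanSpace ℝ (Fin N))
    (hu : MemL1W1 T Ω α u)
    (hdiv : ∀ᵐ t ∂(volume.restrict (Ioo 0 T)), IsWeaklyDivFree Ω (u t))
    (ρ₀ : EuclideanSpace ℝ (Fin N) → ℝ) (hρ₀ : MemLp ρ₀ p (volume.restrict Ω))
    (ρ : ℝ → EuclideanSpace ℝ (Fin N) → ℝ) (hρ : MemLinftyLp T Ω p ρ)
    (hsol : IsWeakSolution T Ω u ρ ρ₀)
    (η : EuclideanSpace ℝ (Fin N) → ℝ) (hη : ContDiff ℝ ∞ η) (hη0 : ∀ x, 0 ≤ η x)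
    (hηs : tsupport η ⊆ Metric.closedBall 0 1)
    (β : ℝ → ℝ) (hβ : ContDiff ℝ 1 β) (hβb : ∃ C : ℝ, ∀ s, |β s| ≤ C)
    (hβb' : ∃ C : ℝ, ∀ s, |deriv β s| ≤ C)
    (φ : ℝ → EuclideanSpace ℝ (Fin N) → ℝ) (hφ : IsTest T Ω φ)
    (Ω₀ : Set (EuclideanSpace ℝ (Fin N))) (hΩ₀ : IsCompact Ω₀) (hΩ₀Ω : Ω₀ ⊆ Ω)
    (hφ0 : ∀ t ∈ Icc 0 T, ∀ x ∈ Ω, x ∉ Ω₀ → φ t x = 0)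
    (ε : ℝ) (hε : 0 < ε)
    (hεd : ∀ x ∈ Ω₀, ENNReal.ofReal ε < Metric.infEDist x (frontier Ω)) :
    -- the convolutions and the error term are given by absolutely convergent integrals
    ((∀ x, IntegrableOn (fun y => ρ₀ y * scaledKernel η ε (x - y)) Ω) ∧
      ∀ᵐ t ∂(volume.restrict (Ioo 0 T)), ∀ x,
        IntegrableOn (fun y => ρ t y * scaledKernel η ε (x - y)) Ω ∧
        IntegrableOn (errorIntegrand η ε (u t) (ρ t) x) Ω) ∧
    -- the equation for the regularized density
    (TransportFormConverges T (innerSet Ω ε) u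
        (fun t => mollify Ω η ε (ρ t)) (mollify Ω η ε ρ₀) φ ∧
      Integrable (fun z : ℝ × EuclideanSpace ℝ (Fin N) =>
        errorTerm Ω η ε (u z.1) (ρ z.1) z.2 * φ z.1 z.2) (spaceTime T Ω) ∧
      transportForm T (innerSet Ω ε) u (fun t => mollify Ω η ε (ρ t)) (mollify Ω η ε ρ₀) φ =
        ∫ t in Ioo 0 T, ∫ x in Ω, errorTerm Ω η ε (u t) (ρ t) x * φ t x) ∧
    -- the renormalized equation for the regularized density
    (TransportFormConverges T (innerSet Ω ε) u
        (fun t x => β (mollify Ω η ε (ρ t) x)) (fun x => β (mollify Ω η ε ρ₀ x)) φ ∧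
      Integrable (fun z : ℝ × EuclideanSpace ℝ (Fin N) =>
        errorTerm Ω η ε (u z.1) (ρ z.1) z.2 * deriv β (mollify Ω η ε (ρ z.1) z.2) * φ z.1 z.2)
        (spaceTime T (innerSet Ω ε)) ∧
      transportForm T (innerSet Ω ε) u
          (fun t x => β (mollify Ω η ε (ρ t) x)) (fun x => β (mollify Ω η ε ρ₀ x)) φ =
        ∫ t in Ioo 0 T, ∫ x in innerSet Ω ε,
          errorTerm Ω η ε (u t) (ρ t) x * deriv β (mollify Ω η ε (ρ t) x) * φ t x) := by
  have : IsFiniteMeasure (volume.restrict Ω) := ⟨by simpa using hΩb.measure_lt_top⟩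
  have hq1 : 1 ≤ q := hpq.symm.one_le
  have hρ₀i : IntegrableOn ρ₀ Ω := hρ₀.integrable hp.le
  obtain ⟨R, -, hR⟩ := hρ.exists_integral_norm_le hp.le
  have hui := hu.integrable (hq1.trans hα)
  have hρu := hρ.integrable_smul hpq hα hu
  have hΩ₀ε : Ω₀ ⊆ innerSet Ω ε := fun x hx => ⟨hΩ₀Ω hx, hεd x hx⟩
  have core : ∀ {b : ℝ → ℝ}, ContDiff ℝ 1 b → _ := fun hb =>
    transportForm_comp_mollify hΩo hT hui hdiv hρ₀i hρ.1 hR hρu hsol hη hηs hε hb hφ hΩ₀ hΩ₀Ω hφ0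
      hΩ₀ε
  refine ⟨⟨integrableOn_mul_scaledKernel hη hηs hε hρ₀i, ?_⟩, ?_, core hβ⟩
  · filter_upwards [hR, hρu.prod_right_ae] with t ht htu x
    exact ⟨integrableOn_mul_scaledKernel hη hηs hε ht.1 x,
      integrableOn_errorIntegrand hη hηs hε ht.1 htu x⟩
  -- For the identity, `deriv β` is `1`. The error integral then extends from the inner set to Ω
  -- because `φ` vanishes in between.
  · obtain ⟨h1, h2, h3⟩ := core (b := fun s => s) contDiff_id
    simp only [deriv_id'', mul_one] at h2 h3
    have hUm := (isOpen_innerSet hΩo ε).measurableSet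
    refine ⟨h1, ?_, h3.trans ?_⟩
    · rw [spaceTime_eq] at h2 ⊢
      refine IntegrableOn.of_forall_sdiff_eq_zero h2
        (measurableSet_Ioo.prod hΩo.measurableSet) fun z hz => ?_
      rw [hφ0 z.1 (Ioo_subset_Icc_self hz.1.1) z.2 hz.1.2 fun h => hz.2 ⟨hz.1.1, hΩ₀ε h⟩, mul_zero]
    · refine setIntegral_congr_fun measurableSet_Ioo fun t ht => ?_
      refine (setIntegral_eq_of_subset_of_forall_sdiff_eq_zero hΩo.measurableSet
        (fun x hx => hx.1) fun x hx => ?_).symm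
      rw [hφ0 t (Ioo_subset_Icc_self ht) x hx.1 fun h => hx.2 (hΩ₀ε h), mul_zero]
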